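/- Let $\mathbf{K}$ be a non-archimedean local field of characteristic $0$ (a finite extension of some $\mathbf{Q}_p$) with valuation ring $\mathfrak{o}_{\mathbf{K}}$. A function on a polydisk $\mathfrak{o}_{\mathbf{K}}^n$ is called analytic (in the sense of Tate), with coefficients in a subring $R\subset\mathbf{K}$, if it is the sum on $\mathfrak{o}_{\mathbf{K}}^n$ of one power series $\sum_I a_I\mathbf{x}^I$ with $a_I\in R$ and $|a_I|\to 0$ as $|I|\to\infty$. Let $V$ be an affine scheme of finite type over $\mathfrak{o}_{\mathbf{K}}$ whose generic fibre is smooth of pure dimension $m$ over $\mathbf{K}$. Let $V(\mathfrak{o}_{\mathbf{K}})$ carry the topology induced by a closed embedding $V\subset\mathbb{A}^N_{\mathfrak{o}_{\mathbf{K}}}$, that is by $V(\mathfrak{o}_{\mathbf{K}})\subset\mathfrak{o}_{\mathbf{K}}^N$. Let $\Gamma$ be a subgroup of the group $\mathrm{Aut}(V_{\mathfrak{o}_{\mathbf{K}}})$ of automorphisms of $V$ over $\mathfrak{o}_{\mathbf{K}}$. Then there is a finite index subgroup $\Gamma_0$ of $\Gamma$ with the following property. For every $x\in V(\mathfrak{o}_{\mathbf{K}})$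 there are a compact open neighbourhood $\mathcal{U}(x)$ of $x$ in $V(\mathfrak{o}_{\mathbf{K}})$ and a bijection $\varphi\colon\mathfrak{o}_{\mathbf{K}}^m\to\mathcal{U}(x)$ such that 1. $\varphi$ is an analytic diffeomorphism: the coordinates of $\varphi$ in $\mathbb{A}^N$ are analytic functions with coefficients in $\mathfrak{o}_{\mathbf{K}}$, and the coordinates of $\varphi^{-1}$ are restrictions to $\mathcal{U}(x)\subset\mathfrak{o}_{\mathbf{K}}^N$ of analytic functions on $\mathfrak{o}_{\mathbf{K}}^N$ with coefficients in $\mathbf{K}$; 2. $f(\mathcal{U}(x))=\mathcal{U}(x)$ for every $f\in\Gamma_0$; 3. for every $f\in\Gamma_0$ there is a unique analytic flow $\Phi_f\colon\mathfrak{o}_{\mathbf{K}}\times\mathcal{U}(x)\to\mathcal{U}(x)$, $(t,y)\mapsto\Phi_f^t(y)$, such that $\Phi_f^n=f^n|_{\mathcal{U}(x)}$ for every $n\in\mathbf{Z}$. Here a flow is a map with $\Phi^{s+t}=\Phi^s\circ\Phi^t$ for all $s,t\in\mathfrak{o}_{\mathbf{K}}$ which, once $\mathcal{U}(x)$ is identified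 with $\mathfrak{o}_{\mathbf{K}}^m$ by $\varphi$, is given by analytic functions of $(t,\mathbf{x})\in\mathfrak{o}_{\mathbf{K}}^{1+m}$; the functions that give $\Phi_f$ have coefficients in $\mathfrak{o}_{\mathbf{K}}$, and $\Phi_f$ is unique even among the flows given by analytic functions with coefficients in $\mathbf{K}$. -/

import Mathlib

open scoped TensorProduct

universe u

namespace PadicFlow

section Points

variable (R A : Type u) [CommRing R] [CommRing A] [Algebra R A]

/-- The set `V(R)` of `R`-points of the affine `R`-scheme `V = Spec A`. -/
def Points : Type u := A →ₐ[R] R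

variable {R A}

/-- An `R`-point of `Spec A`, as a homomorphism of `R`-algebras. -/
def Points.toAlgHom (x : Points R A) : A →ₐ[R] R := x

/-- The value `a(x)` of a regular function `a` at an `R`-point `x` of `V = Spec A`. -/
def Points.eval (x : Points R A) (a : A) : R := x.toAlgHom a

/-- The topology of `V(R)`: the coarsest one for which every regular function `a : V(R) → R` is
continuous. It is the subspace topology for every closed embedding `V(R) ⊆ R ^ N`, see
`Points.isEmbedding_coord`. -/
instance [TopologicalSpace R] : TopologicalSpace (Points R A) :=
  TopologicalSpace.induced (fun (x : Points R A) (a : A) => x.eval a) Pi.topologicalSpace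

theorem Points.continuous_eval_comp [TopologicalSpace R] [IsTopologicalRing R]
    {T : Type*} [TopologicalSpace T] (g : T → Points R A) {S : Set A}
    (hS : Algebra.adjoin R S = ⊤) (hg : ∀ a ∈ S, Continuous fun t => (g t).eval a) (b : A) :
    Continuous fun t => (g t).eval b := by
  have hb : b ∈ Algebra.adjoin R S := hS ▸ Algebra.mem_top
  induction hb using Algebra.adjoin_induction with
  | mem b hb => exact hg b hb
  | algebraMap r => simpa [Points.eval] using continuous_const
  | add b c _ _ hb hc => exact (hb.add hc).congr fun t => (map_add (g t).toAlgHom b c).symm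
  | mul b c _ _ hb hc => exact (hb.mul hc).congr fun t => (map_mul (g t).toAlgHom b c).symm

/-- A choice of generators `a₁, …, a_N` of the coordinate ring, that is of a closed embedding of `V`
into the affine space of dimension `N`, embeds `V(R)` as a topological subspace of `R ^ N`. -/
theorem Points.isEmbedding_coord [TopologicalSpace R] [IsTopologicalRing R] {N : ℕ}
    (a : Fin N → A) (ha : Algebra.adjoin R (Set.range a) = ⊤) :
    Topology.IsEmbedding (fun (x : Points R A) (i : Fin N) => x.eval (a i)) where
  eq_induced := by
    apply le_antisymm
    · exact continuous_iff_le_induced.mp (continuous_pi fun i =>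
        (continuous_apply (a i)).comp
          (continuous_induced_dom (f := fun (x : Points R A) (a : A) => x.eval a)))
    · let τ : TopologicalSpace (Points R A) :=
        TopologicalSpace.induced (fun (x : Points R A) (i : Fin N) => x.eval (a i))
          Pi.topologicalSpace
      have h : @Continuous _ _ τ _ (fun (x : Points R A) (b : A) => x.eval b) := by
        refine @continuous_pi _ _ _ τ _ _ fun b => ?_
        refine @Points.continuous_eval_comp R A _ _ _ _ _ (Points R A) τ id _ ha ?_ b
        rintro _ ⟨i, rfl⟩
        exact @Continuous.comp _ _ _ τ _ _ _ _ (continuous_apply i)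
          (@continuous_induced_dom _ _ (fun (x : Points R A) (i : Fin N) => x.eval (a i)) _)
      exact continuous_iff_le_induced.mp h
  injective x y h := by
    refine AlgHom.ext_of_adjoin_eq_top (φ₁ := x.toAlgHom) (φ₂ := y.toAlgHom) ha ?_
    rintro _ ⟨i, rfl⟩
    exact congrFun h i

variable (R A) in
/-- The group `Aut(V_R)` of automorphisms over `R` of the affine `R`-scheme `V = Spec A`. An
automorphism `f` is recorded by its comorphism `f^*`, which is an automorphism of the `R`-algebra
`A`; as `(f ∘ g)^* = g^* ∘ f^*`, the group is the opposite of that of algebra automorphisms. -/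
abbrev AutScheme : Type u := (A ≃ₐ[R] A)ᵐᵒᵖ

/-- The action of `Aut(V_R)` on `V(R)`, given by `a (f x) = (f^* a)(x)`. -/
instance : MulAction (AutScheme R A) (Points R A) where
  smul f x := x.toAlgHom.comp (f.unop : A →ₐ[R] A)
  one_smul _ := rfl
  mul_smul _ _ _ := rfl

end Points

noncomputable section Analytic

variable {K : Type u} [NontriviallyNormedField K] [IsUltrametricDist K]

variable (K) in
/-- The valuation ring `{x | ‖x‖ ≤ 1}` of a non-archimedean field. -/
abbrev ValRing : ValuationSubring K := (NormedField.valuation (K := K)).valuationSubring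

/-- `F` is an analytic function, in the sense of Tate, on the polydisk of dimension `n`, with
coefficients in the subring `R` of `K`: it is the sum on the whole polydisk of one power series whose
coefficients lie in `R` and tend to `0`. -/
def IsTate (R : Subring K) {n : ℕ} (F : (Fin n → ValRing K) → K) : Prop :=
  ∃ P : MvPowerSeries (Fin n) K,
    (∀ I, MvPowerSeries.coeff I P ∈ R) ∧ MvPowerSeries.IsRestricted (fun _ => 1) P ∧
      ∀ x, HasSum (fun I : Fin n →₀ ℕ => MvPowerSeries.coeff I P * ∏ i, (x i : K) ^ I i) (F x)

variable {A : Type u} [CommRing A] [Algebra (ValRing K) A] {m : ℕ} {U : Set (Points (ValRing K) A)}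

/-- The bijection `φ` from the polydisk of dimension `m` onto a subset `U` of `V(𝔬)` is an analytic
diffeomorphism. Analyticity of `φ`: the coordinates of `φ` (equivalently, the composition of `φ` with
any regular function) are Tate series with coefficients in the valuation ring. Analyticity of `φ⁻¹`:
its coordinates are the restriction to `U` of Tate series, with coefficients in `K`, in finitely many
coordinates of an affine space that contains `V`. -/
structure IsAnalyticDiffeo (φ : (Fin m → ValRing K) ≃ U) : Prop where
  analytic : ∀ a : A, IsTate (ValRing K).toSubring (fun t => ((φ t).1.eval a : K))
  analytic_symm : ∀ i : Fin m, ∃ (n : ℕ) (a : Fin n → A) (G : (Fin n → ValRing K) → K),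
    IsTate ⊤ G ∧ ∀ y : U, (φ.symm y i : K) = G (fun j => y.1.eval (a j))

/-- `Φ` is an analytic flow, parametrized by the valuation ring, on the set `U` identified with the
polydisk of dimension `m` through `φ`: as a map of `(t, x)` from the polydisk of dimension `1 + m` to
the polydisk of dimension `m`, it is given by Tate series with coefficients in `R`, and
`Φ ^ (s + t) = Φ ^ s ∘ Φ ^ t`. -/
structure IsAnalyticFlow (R : Subring K) (φ : (Fin m → ValRing K) ≃ U)
    (Φ : ValRing K → U → U) : Prop where
  analytic : ∀ i : Fin m, IsTate R (fun z : Fin (m + 1) → ValRing K =>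
    (φ.symm (Φ (z 0) (φ (Fin.tail z))) i : K))
  map_add : ∀ (s t : ValRing K) (y : U), Φ (s + t) y = Φ s (Φ t y)

end Analytic

end PadicFlow

/-!
Write `𝔬` for the valuation ring and `p` for the residue characteristic. Two facts carry the proof.

*Maps close to the identity embed in flows* (`exists_flow`). Let `F` be an analytic map of the
polydisk `𝔬 ^ n` to itself with `F ≡ id` modulo `p ^ 2`, coefficient by coefficient. The operator
`Δ g = g ∘ F - g` multiplies Gauss norms by at most `‖p‖ ^ 2`, so the binomial series
`∑ k, (t choose k) Δ ^ k` converges for all `t ∈ 𝔬` and defines maps `Φ t` with `Φ N = F ^ N` for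
natural numbers `N`. A Tate series in one variable that vanishes at all natural numbers is zero
(`IsTateLE.eq_of_forall_natCast`); this gives `Φ (s + t) = Φ s ∘ Φ t` and the uniqueness of `Φ`. As
`Φ (-1)` inverts `F`, the same statement serves as an inverse function theorem (`exists_inverse`).

*There are charts with linear inverse* (`exists_parametrization`). Let `x ∈ V(𝔬)`, with generators
`a` of the coordinate ring that vanish at `x`, and let `I` be the ideal of the generic fibre in
`K[X]`. Smoothness at `x` provides finitely many `f i ∈ I` with linearly independent differentials
that generate `I` near `x`, by the split injection `I / I ^ 2 → Ω` and Nakayama's lemma; the tangent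
space has dimension `m` because the Kähler differentials of a standard smooth localization are free
of rank `m` (`exists_local_equations`). After rescaling by a power of `p`, a map congruent to the
identity straightens the zeros of `f` to the tangent space (`exists_local_parametrization`). This
yields `ψ : 𝔬 ^ m → V(𝔬)`, with integral coefficients, whose parameters are linear forms in the
coordinates `a`.

Let now `f` be an automorphism that acts trivially on `V(𝔬)` modulo `p ^ (2 * k)`. For a coordinate
`a`, the function `a ∘ f ∘ ψ - a ∘ ψ` has Gauss norm at most `1` and values of norm at most
`‖p ^ k‖ ^ 2`; therefore its restriction to the polydisk of radius `‖p ^ k‖` has Gauss norm at most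
`‖p ^ k‖ ^ 2` (`IsTateLE.comp_smul_of_norm_le`). The parameters `t` on that polydisk are recovered
from the coordinates `a` at the cost of a factor `p ^ (-k)` times a constant, so for large `k` the
map `f` reads `t ↦ t` modulo `p ^ 2` and embeds in a flow (`exists_invariant_chart`). The exponent
`k` depends on the chart only. As `V(𝔬)` is compact, finitely many charts suffice, and one
congruence subgroup, of finite index because `V(𝔬)` modulo `p ^ M` is finite, works for all of them.
-/

open Filter Topology

namespace PadicFlow


/-! ### Tate series of bounded Gauss norm -/

section

variable {K : Type u} [NontriviallyNormedField K] [IsUltrametricDist K]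

theorem mem_valRing_iff {x : K} : x ∈ ValRing K ↔ ‖x‖ ≤ 1 := by
  rw [Valuation.mem_valuationSubring_iff, ← NNReal.coe_le_coe]
  rfl

theorem norm_coe_le_one (x : ValRing K) : ‖(x : K)‖ ≤ 1 := mem_valRing_iff.mp x.2

theorem norm_le_of_hasSum {ι : Type*} {f : ι → K} {a : K} {r : ℝ} (hf : HasSum f a)
    (hr : 0 ≤ r) (h : ∀ i, ‖f i‖ ≤ r) : ‖a‖ ≤ r := by
  rw [← hf.tsum_eq]
  exact (IsUltrametricDist.norm_tsum_le f).trans (Real.iSup_le h hr)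

omit [IsUltrametricDist K] in
theorem norm_prod_pow_le_one {ι : Type*} (s : Finset ι) {y : ι → K} (hy : ∀ i, ‖y i‖ ≤ 1)
    (I : ι → ℕ) : ‖∏ i ∈ s, y i ^ I i‖ ≤ 1 := by
  rw [norm_prod]
  refine Finset.prod_le_one (fun _ _ => norm_nonneg _) fun i _ => ?_
  rw [norm_pow]
  exact pow_le_one₀ (norm_nonneg _) (hy i)

/-- `F` is the sum on the polydisk of dimension `n` of a power series with coefficients tending to
`0` and of norm at most `r`, that is, of Gauss norm at most `r`. -/
def IsTateLE (r : ℝ) {n : ℕ} (F : (Fin n → ValRing K) → K) : Prop :=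
  ∃ c : (Fin n →₀ ℕ) → K, (∀ I, ‖c I‖ ≤ r) ∧ Tendsto c cofinite (𝓝 0) ∧
    ∀ x, HasSum (fun I => c I * ∏ i, (x i : K) ^ I i) (F x)

variable {n m : ℕ}

omit [IsUltrametricDist K] in
theorem isRestricted_one_iff (P : MvPowerSeries (Fin n) K) :
    MvPowerSeries.IsRestricted (fun _ => 1) P ↔
      Tendsto (fun I => MvPowerSeries.coeff I P) cofinite (𝓝 0) := by
  simp [MvPowerSeries.IsRestricted, tendsto_zero_iff_norm_tendsto_zero (f := fun I =>
    MvPowerSeries.coeff I P)]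

theorem IsTateLE.isTate {F : (Fin n → ValRing K) → K} (h : IsTateLE 1 F) :
    IsTate (ValRing K).toSubring F := by
  obtain ⟨c, h1, h2, h3⟩ := h
  exact ⟨c, fun I => mem_valRing_iff.mpr (h1 I), (isRestricted_one_iff c).mpr h2, h3⟩

theorem IsTateLE.isTate_top {r : ℝ} {F : (Fin n → ValRing K) → K} (h : IsTateLE r F) :
    IsTate ⊤ F := by
  obtain ⟨c, h1, h2, h3⟩ := h
  exact ⟨c, fun I => trivial, (isRestricted_one_iff c).mpr h2, h3⟩

omit [IsUltrametricDist K] in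
theorem exists_norm_le_of_tendsto_cofinite {ι : Type*} {c : ι → K}
    (h : Tendsto c cofinite (𝓝 0)) : ∃ r, 0 ≤ r ∧ ∀ i, ‖c i‖ ≤ r := by
  have h1 : ∀ᶠ i in cofinite, ‖c i‖ < 1 := by
    simpa using (Metric.tendsto_nhds.mp h) 1 one_pos
  have hfin : {i | ¬ ‖c i‖ < 1}.Finite := h1
  obtain ⟨r, hr⟩ := (hfin.image fun i => ‖c i‖).bddAbove
  refine ⟨max r 1, by positivity, fun i => ?_⟩
  by_cases hi : ‖c i‖ < 1
  · exact hi.le.trans (le_max_right _ _)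
  · exact (hr ⟨i, hi, rfl⟩).trans (le_max_left _ _)

theorem IsTate.exists_isTateLE {R : Subring K} {F : (Fin n → ValRing K) → K} (h : IsTate R F) :
    ∃ r, 0 ≤ r ∧ IsTateLE r F := by
  obtain ⟨P, -, h2, h3⟩ := h
  rw [isRestricted_one_iff] at h2
  obtain ⟨r, hr, h⟩ := exists_norm_le_of_tendsto_cofinite h2
  exact ⟨r, hr, fun I => MvPowerSeries.coeff I P, h, h2, h3⟩

theorem IsTateLE.nonneg {r : ℝ} {F : (Fin n → ValRing K) → K} (h : IsTateLE r F) : 0 ≤ r := by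
  obtain ⟨c, h1, -, -⟩ := h
  exact (norm_nonneg _).trans (h1 0)

theorem IsTateLE.mono {r s : ℝ} {F : (Fin n → ValRing K) → K} (h : IsTateLE r F) (hrs : r ≤ s) :
    IsTateLE s F := by
  obtain ⟨c, h1, h2, h3⟩ := h
  exact ⟨c, fun I => (h1 I).trans hrs, h2, h3⟩

theorem IsTateLE.norm_le {r : ℝ} {F : (Fin n → ValRing K) → K} (h : IsTateLE r F)
    (x : Fin n → ValRing K) : ‖F x‖ ≤ r := by
  have hr := h.nonneg
  obtain ⟨c, h1, h2, h3⟩ := h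
  refine norm_le_of_hasSum (h3 x) hr fun I => ?_
  rw [norm_mul]
  exact (mul_le_of_le_one_right (norm_nonneg _)
    (norm_prod_pow_le_one _ (fun i => norm_coe_le_one (x i)) _)).trans (h1 I)

theorem isTateLE_single (a : K) (I : Fin n →₀ ℕ) :
    IsTateLE ‖a‖ fun x : Fin n → ValRing K => a * ∏ i, (x i : K) ^ I i := by
  classical
  refine ⟨Pi.single I a, fun J => ?_, ?_, fun x => ?_⟩
  · by_cases h : J = I
    · subst h; simp
    · simp [h]
  · refine tendsto_nhds_of_eventually_eq ?_
    refine (Set.finite_singleton I).subset fun J hJ => ?_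
    by_contra h
    exact hJ (by simp [Pi.single_eq_of_ne (show J ≠ I from h)])
  · have h := hasSum_single (f := fun J => (Pi.single I a : (Fin n →₀ ℕ) → K) J *
      ∏ i, (x i : K) ^ J i) I fun J hJ => by simp [hJ]
    simpa using h

theorem isTateLE_const (a : K) : IsTateLE ‖a‖ fun _ : Fin n → ValRing K => a := by
  simpa using isTateLE_single (n := n) a 0

theorem isTateLE_coord (i : Fin n) : IsTateLE 1 fun x : Fin n → ValRing K => (x i : K) := by
  classical
  have h := isTateLE_single (n := n) (1 : K) (Finsupp.single i 1)
  simp only [one_mul, norm_one] at h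
  convert! h using 2 with x
  rw [Finset.prod_eq_single i] <;> simp +contextual [eq_comm]

theorem IsTateLE.const_mul {r : ℝ} {F : (Fin n → ValRing K) → K} (h : IsTateLE r F) (a : K) :
    IsTateLE (‖a‖ * r) fun x => a * F x := by
  obtain ⟨c, h1, h2, h3⟩ := h
  refine ⟨fun I => a * c I, fun I => ?_, by simpa using h2.const_mul a, fun x => ?_⟩
  · rw [norm_mul]
    exact mul_le_mul_of_nonneg_left (h1 I) (norm_nonneg _)
  · simpa [mul_assoc] using (h3 x).mul_left a

theorem IsTateLE.add {r : ℝ} {F G : (Fin n → ValRing K) → K} (hF : IsTateLE r F)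
    (hG : IsTateLE r G) : IsTateLE r fun x => F x + G x := by
  obtain ⟨c, h1, h2, h3⟩ := hF
  obtain ⟨d, g1, g2, g3⟩ := hG
  refine ⟨fun I => c I + d I, fun I => ?_, by simpa using h2.add g2, fun x => ?_⟩
  · exact (IsUltrametricDist.norm_add_le_max _ _).trans (max_le (h1 I) (g1 I))
  · simpa [add_mul] using (h3 x).add (g3 x)

theorem IsTateLE.sub {r : ℝ} {F G : (Fin n → ValRing K) → K} (hF : IsTateLE r F)
    (hG : IsTateLE r G) : IsTateLE r fun x => F x - G x := by
  have := hF.add ((hG.const_mul (-1)).mono (by simp))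
  simpa [sub_eq_add_neg] using this

theorem IsTateLE.sum {ι : Type*} (s : Finset ι) {F : ι → (Fin n → ValRing K) → K} {r : ℝ}
    (hr : 0 ≤ r) (hF : ∀ k ∈ s, IsTateLE r (F k)) : IsTateLE r fun x => ∑ k ∈ s, F k x := by
  classical
  induction s using Finset.induction_on with
  | empty => simpa using (isTateLE_const (n := n) (0 : K)).mono (by simpa using hr)
  | insert a s ha ih =>
    simp only [Finset.sum_insert ha]
    exact (hF a (by simp)).add (ih fun k hk => hF k (by simp [hk]))

theorem IsTateLE.monomial_mul {r : ℝ} {F : (Fin n → ValRing K) → K} (h : IsTateLE r F)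
    (I : Fin n →₀ ℕ) : IsTateLE r fun x => (∏ i, (x i : K) ^ I i) * F x := by
  have hr := h.nonneg
  obtain ⟨c, h1, h2, h3⟩ := h
  have hinj : Function.Injective fun J : Fin n →₀ ℕ => I + J := add_right_injective I
  refine ⟨Function.extend (fun J => I + J) c 0, fun J => ?_, ?_, fun x => ?_⟩
  · by_cases hJ : ∃ J', I + J' = J
    · obtain ⟨J', rfl⟩ := hJ
      rw [hinj.extend_apply (g := c)]
      exact h1 J'
    · rw [Function.extend_apply' _ _ _ hJ]
      simpa using hr
  · rw [Metric.tendsto_nhds] at h2 ⊢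
    intro ε hε
    have hfin : {J | ¬ dist (c J) 0 < ε}.Finite := h2 ε hε
    refine Set.Finite.subset (hfin.image fun J => I + J) fun J hJ => ?_
    by_cases hJ' : ∃ J', I + J' = J
    · obtain ⟨J', rfl⟩ := hJ'
      refine ⟨J', fun h => hJ ?_, rfl⟩
      simpa [hinj.extend_apply (g := c)] using h
    · exact (hJ (by simpa [Function.extend_apply' _ _ _ hJ'] using hε)).elim
  · rw [← hinj.hasSum_iff]
    · convert! (h3 x).mul_left (∏ i, (x i : K) ^ I i) using 2 with J
      simp only [Function.comp_apply, hinj.extend_apply (g := c), Finsupp.add_apply, pow_add,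
        Finset.prod_mul_distrib]
      ring
    · intro J hJ
      rw [Function.extend_apply' _ _ _ (by simpa using hJ)]
      simp

section Complete

variable [CompleteSpace K]

theorem summable_of_norm_le {ι : Type*} {f : ι → K} {r : ι → ℝ} (hf : ∀ i, ‖f i‖ ≤ r i)
    (hr : Tendsto r cofinite (𝓝 0)) : Summable f :=
  NonarchimedeanAddGroup.summable_of_tendsto_cofinite_zero (squeeze_zero_norm hf hr)

omit [IsUltrametricDist K] [CompleteSpace K] in
theorem tendsto_cofinite_prod {ι κ : Type*} {f : ι × κ → K} {r : ι → ℝ}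
    (hf : ∀ i j, ‖f (i, j)‖ ≤ r i) (hr : Tendsto r cofinite (𝓝 0))
    (h : ∀ i, Tendsto (fun j => f (i, j)) cofinite (𝓝 0)) :
    Tendsto f cofinite (𝓝 0) := by
  rw [Metric.tendsto_nhds]
  intro ε hε
  have h1 : {i | ¬ r i < ε}.Finite := by
    have := (Metric.tendsto_nhds.mp hr) ε hε
    refine Set.Finite.subset this fun i hi hi' => hi ?_
    have hi'' : dist (r i) 0 < ε := hi'
    rw [dist_zero_right] at hi''
    exact (le_abs_self _).trans_lt hi''
  have h2 : ∀ i, {j | ¬ dist (f (i, j)) 0 < ε}.Finite := fun i =>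
    (Metric.tendsto_nhds.mp (h i)) ε hε
  refine Set.Finite.subset (h1.biUnion fun i _ => (h2 i).image (Prod.mk i)) ?_
  rintro ⟨i, j⟩ hij
  simp only [Set.mem_iUnion]
  refine ⟨i, fun hi => hij ?_, j, hij, rfl⟩
  simp only [Set.mem_ofPred_eq, dist_zero_right]
  exact (hf i j).trans_lt hi

/-- A sum of Tate series whose Gauss norms tend to `0` is a Tate series. -/
theorem IsTateLE.of_hasSum {ι : Type*} {F : ι → (Fin n → ValRing K) → K} {r : ι → ℝ}
    (hF : ∀ k, IsTateLE (r k) (F k)) (hr : Tendsto r cofinite (𝓝 0)) {R : ℝ} (hR0 : 0 ≤ R)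
    (hR : ∀ k, r k ≤ R) {G : (Fin n → ValRing K) → K} (hG : ∀ x, HasSum (fun k => F k x) (G x)) :
    IsTateLE R G := by
  choose c h1 h2 h3 using hF
  have hsum : ∀ I, Summable fun k => c k I := fun I =>
    summable_of_norm_le (fun k => h1 k I) hr
  -- the double series of all terms tends to `0` along the cofinite filter, so it may be summed in
  -- either order
  refine ⟨fun I => ∑' k, c k I, fun I => norm_le_of_hasSum (hsum I).hasSum hR0
    fun k => (h1 k I).trans (hR k), ?_, fun x => ?_⟩
  · have ht : Tendsto (fun q : ι × (Fin n →₀ ℕ) => c q.1 q.2) cofinite (𝓝 0) :=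
      tendsto_cofinite_prod h1 hr h2
    rw [Metric.tendsto_nhds] at ht ⊢
    intro ε hε
    have hfin : {q : ι × (Fin n →₀ ℕ) | ¬ dist (c q.1 q.2) 0 < ε / 2}.Finite := ht _ (half_pos hε)
    refine Set.Finite.subset (hfin.image Prod.snd) fun I hI => ?_
    by_contra hcon
    refine hI ?_
    simp only [Set.mem_ofPred_eq, dist_zero_right]
    refine (norm_le_of_hasSum (hsum I).hasSum (half_pos hε).le fun k => ?_).trans_lt
      (half_lt_self hε)
    by_contra hk
    exact hcon ⟨(k, I), fun h => hk (by simpa using h.le), rfl⟩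
  · have hx : ∀ I : Fin n →₀ ℕ, ‖∏ i, (x i : K) ^ I i‖ ≤ 1 := fun I =>
      norm_prod_pow_le_one _ (fun i => norm_coe_le_one (x i)) _
    have hle : ∀ k I, ‖c k I * ∏ i, (x i : K) ^ I i‖ ≤ ‖c k I‖ := fun k I => by
      rw [norm_mul]
      exact mul_le_of_le_one_right (norm_nonneg _) (hx I)
    have ht : Tendsto (fun q : ι × (Fin n →₀ ℕ) => c q.1 q.2 * ∏ i, (x i : K) ^ q.2 i)
        cofinite (𝓝 0) :=
      tendsto_cofinite_prod (fun k I => (hle k I).trans (h1 k I)) hr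
        fun k => squeeze_zero_norm (hle k) (tendsto_zero_iff_norm_tendsto_zero.mp (h2 k))
    have hs := (NonarchimedeanAddGroup.summable_of_tendsto_cofinite_zero ht).hasSum
    have h4 := hs.prod_fiberwise fun k => h3 k x
    rw [← (hG x).unique h4] at hs
    refine HasSum.prod_fiberwise (f := fun q : (Fin n →₀ ℕ) × ι =>
      c q.2 q.1 * ∏ i, (x i : K) ^ q.1 i) ((Equiv.prodComm _ _).hasSum_iff.mp ?_) fun I => ?_
    · exact hs
    · exact (hsum I).hasSum.mul_right _

theorem IsTateLE.mul {r s : ℝ} {F G : (Fin n → ValRing K) → K} (hF : IsTateLE r F)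
    (hG : IsTateLE s G) : IsTateLE (r * s) fun x => F x * G x := by
  have hr := hF.nonneg
  have hs := hG.nonneg
  obtain ⟨c, h1, h2, h3⟩ := hF
  refine IsTateLE.of_hasSum (fun I => (hG.monomial_mul I).const_mul (c I)) (R := r * s) ?_
    (by positivity) (fun I => mul_le_mul_of_nonneg_right (h1 I) hs) fun x => ?_
  · simpa using (tendsto_zero_iff_norm_tendsto_zero.mp h2).mul_const s
  · simpa [mul_assoc] using (h3 x).mul_right (G x)

theorem IsTateLE.mul_of_one {F G : (Fin n → ValRing K) → K} (hF : IsTateLE 1 F)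
    (hG : IsTateLE 1 G) : IsTateLE 1 fun x => F x * G x := by
  simpa using hF.mul hG

theorem IsTateLE.pow {F : (Fin n → ValRing K) → K} (hF : IsTateLE 1 F) (k : ℕ) :
    IsTateLE 1 fun x => F x ^ k := by
  induction k with
  | zero => simpa using isTateLE_const (n := n) (1 : K)
  | succ k ih => simpa [pow_succ] using ih.mul hF

theorem IsTateLE.prod {ι : Type*} (s : Finset ι) {F : ι → (Fin n → ValRing K) → K}
    (hF : ∀ k ∈ s, IsTateLE 1 (F k)) : IsTateLE 1 fun x => ∏ k ∈ s, F k x := by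
  classical
  induction s using Finset.induction_on with
  | empty => simpa using isTateLE_const (n := n) (1 : K)
  | insert a s ha ih =>
    simp only [Finset.prod_insert ha]
    exact (hF a (by simp)).mul_of_one (ih fun k hk => hF k (by simp [hk]))

/-- Substitution of integral Tate series in a Tate series. -/
theorem IsTateLE.comp {r : ℝ} {F : (Fin n → ValRing K) → K} (hF : IsTateLE r F)
    {G : (Fin m → ValRing K) → Fin n → ValRing K} (hG : ∀ i, IsTateLE 1 fun x => (G x i : K)) :
    IsTateLE r fun x => F (G x) := by
  have hr := hF.nonneg
  obtain ⟨c, h1, h2, h3⟩ := hF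
  refine IsTateLE.of_hasSum (r := fun I => ‖c I‖) (fun I => ?_)
    (tendsto_zero_iff_norm_tendsto_zero.mp h2) hr h1 fun x => h3 (G x)
  simpa using (IsTateLE.prod Finset.univ fun i _ => (hG i).pow (I i)).const_mul (c I)

/-- If `G` and `G'` are congruent up to Gauss norm `ε`, so are the powers and the products of their
coordinates. -/
theorem IsTateLE.prod_pow_sub_prod_pow {ι : Type*} (s : Finset ι) {ε : ℝ} (hε : 0 ≤ ε)
    {G G' : ι → (Fin n → ValRing K) → K} (hG : ∀ i, IsTateLE 1 (G i))
    (hG' : ∀ i, IsTateLE 1 (G' i)) (h : ∀ i, IsTateLE ε fun x => G i x - G' i x) (I : ι → ℕ) :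
    IsTateLE ε fun x => (∏ i ∈ s, G i x ^ I i) - ∏ i ∈ s, G' i x ^ I i := by
  classical
  have hmul : ∀ {a b a' b' : (Fin n → ValRing K) → K}, IsTateLE 1 a → IsTateLE 1 b' →
      (IsTateLE ε fun x => a x - a' x) → (IsTateLE ε fun x => b x - b' x) →
      IsTateLE ε fun x => a x * b x - a' x * b' x := fun ha hb' h1 h2 => by
    have h3 := ((ha.mul h2).mono (one_mul ε).le).add ((h1.mul hb').mono (mul_one ε).le)
    convert! h3 using 2 with x
    ring
  have hpow : ∀ i k, IsTateLE ε fun x => G i x ^ k - G' i x ^ k := fun i k => by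
    induction k with
    | zero => simpa using (isTateLE_const (n := n) (0 : K)).mono (by simpa using hε)
    | succ k ih =>
      simp only [pow_succ]
      exact hmul ((hG i).pow k) (hG' i) ih (h i)
  induction s using Finset.induction_on with
  | empty => simpa using (isTateLE_const (n := n) (0 : K)).mono (by simpa using hε)
  | insert a s ha ih =>
    simp only [Finset.prod_insert ha]
    exact hmul ((hG a).pow _) (IsTateLE.prod s fun i _ => (hG' i).pow _) (hpow a _) ih

/-- The operator `F ↦ F ∘ G - F` contracts the Gauss norm by the factor `ε` if `G` is congruent to
the identity up to `ε`. -/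
theorem IsTateLE.comp_sub {r ε : ℝ} {F : (Fin n → ValRing K) → K} (hF : IsTateLE r F)
    {G : (Fin n → ValRing K) → Fin n → ValRing K} (hG : ∀ i, IsTateLE 1 fun x => (G x i : K))
    (hε : 0 ≤ ε) (h : ∀ i, IsTateLE ε fun x => (G x i : K) - x i) :
    IsTateLE (r * ε) fun x => F (G x) - F x := by
  have hr := hF.nonneg
  obtain ⟨c, h1, h2, h3⟩ := hF
  refine IsTateLE.of_hasSum (r := fun I => ‖c I‖ * ε) (fun I => ?_) ?_ (by positivity)
    (fun I => mul_le_mul_of_nonneg_right (h1 I) hε) fun x => (h3 (G x)).sub (h3 x)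
  · simpa [mul_sub] using ((IsTateLE.prod_pow_sub_prod_pow Finset.univ hε hG
      (fun i => isTateLE_coord i) h I).const_mul (c I))
  · simpa using (tendsto_zero_iff_norm_tendsto_zero.mp h2).mul_const ε

end Complete

/-- A Tate series in one variable that vanishes at a sequence of nonzero points that tends to `0` is
zero: otherwise its lowest nonzero term would dominate. -/
theorem IsTateLE.eq_zero_of_tendsto_zero {r : ℝ} {F : (Fin 1 → ValRing K) → K} (hF : IsTateLE r F)
    {u : ℕ → ValRing K} (hu : Tendsto (fun k => (u k : K)) atTop (𝓝 0)) (hu0 : ∀ k, (u k : K) ≠ 0)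
    (h : ∀ k, F (fun _ => u k) = 0) (x : Fin 1 → ValRing K) : F x = 0 := by
  have hr := hF.nonneg
  obtain ⟨c, h1, h2, h3⟩ := hF
  let e : ℕ ≃ (Fin 1 →₀ ℕ) := (Finsupp.uniqueEquiv (0 : Fin 1)).symm
  have he : ∀ d, e d 0 = d := fun d => by
    simp [e]
  have h3' : ∀ y : Fin 1 → ValRing K, HasSum (fun d : ℕ => c (e d) * (y 0 : K) ^ d) (F y) := by
    intro y
    have := e.hasSum_iff.mpr (h3 y)
    simpa [Function.comp_def, he] using this
  -- induction on the degree: divided by `u k ^ d`, the equation `F (u k) = 0` bounds the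
  -- coefficient of degree `d` by a constant times `‖u k‖`
  suffices hc : ∀ d, c (e d) = 0 by
    have := h3' x
    simp only [hc, zero_mul] at this
    exact this.unique hasSum_zero
  intro d
  induction d using Nat.strong_induction_on with
  | _ d ih =>
    have hle : ∀ k, ‖c (e d)‖ ≤ r * ‖(u k : K)‖ := by
      intro k
      have hs := h3' fun _ => u k
      rw [h k] at hs
      have hs' := hs.sub (hasSum_ite_eq d (c (e d) * (u k : K) ^ d))
      have hu1 := norm_coe_le_one (u k)
      have hpos : 0 < ‖(u k : K)‖ ^ d := pow_pos (norm_pos_iff.mpr (hu0 k)) d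
      have hle := norm_le_of_hasSum hs' (r := r * ‖(u k : K)‖ * ‖(u k : K)‖ ^ d) (by positivity) ?_
      · rw [zero_sub, norm_neg, norm_mul, norm_pow] at hle
        exact le_of_mul_le_mul_right hle hpos
      intro d'
      by_cases hd : d' = d
      · subst hd
        simp only [if_true, sub_self, norm_zero]
        positivity
      rw [if_neg hd, sub_zero, norm_mul, norm_pow]
      rcases lt_or_gt_of_ne hd with hd | hd
      · rw [ih d' hd, norm_zero, zero_mul]
        positivity
      · rw [mul_assoc, ← pow_succ']
        exact mul_le_mul (h1 _) (pow_le_pow_of_le_one (norm_nonneg _) hu1 hd) (by positivity) hr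
    have ht : Tendsto (fun k => r * ‖(u k : K)‖) atTop (𝓝 0) := by
      simpa using (tendsto_zero_iff_norm_tendsto_zero.mp hu).const_mul r
    exact norm_le_zero_iff.mp (ge_of_tendsto' ht hle)

end

/-! ### Interpolation of iterates by flows -/

section

variable {K : Type u} [NontriviallyNormedField K] [IsUltrametricDist K]

/-- The residue characteristic of a local field of characteristic `0` is positive: otherwise the
integers would be an infinite discrete subset of the compact unit ball. -/
theorem exists_prime_norm_lt_one [LocallyCompactSpace K] [CharZero K] :
    ∃ p : ℕ, p.Prime ∧ ‖(p : K)‖ < 1 := by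
  by_contra! hcon
  have h1 : ∀ N : ℕ, N ≠ 0 → ‖(N : K)‖ = 1 := by
    intro N
    induction N using Nat.recOnMul with
    | zero => simp
    | one => simp
    | prime q hq =>
      exact fun _ => le_antisymm (IsUltrametricDist.norm_natCast_le_one K q) (hcon q hq)
    | mul a b ha hb =>
      intro hab
      rw [Nat.cast_mul, norm_mul, ha (left_ne_zero_of_mul hab), hb (right_ne_zero_of_mul hab),
        one_mul]
  have : ProperSpace K := ProperSpace.of_locallyCompactSpace K
  obtain ⟨a, -, φ, hφ, hlim⟩ := (isCompact_closedBall (0 : K) 1).tendsto_subseq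
    (x := fun N : ℕ => (N : K)) fun N => by simpa using IsUltrametricDist.norm_natCast_le_one K N
  have hd := (hlim.comp (tendsto_add_atTop_nat 1)).sub hlim
  rw [sub_self] at hd
  obtain ⟨N, hN⟩ := ((Metric.tendsto_nhds.mp hd) 1 one_pos).exists
  have hlt := hφ (Nat.lt_succ_self N)
  simp only [Function.comp_apply, dist_zero_right] at hN
  rw [← Nat.cast_sub hlt.le, h1 _ (Nat.sub_ne_zero_of_lt hlt)] at hN
  exact lt_irrefl _ hN

variable {p : ℕ}

theorem norm_natCast_eq_one_of_coprime (hp1 : ‖(p : K)‖ < 1) {N : ℕ} (h : Nat.Coprime p N) :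
    ‖(N : K)‖ = 1 := by
  refine le_antisymm (IsUltrametricDist.norm_natCast_le_one K N) (le_of_not_gt fun hN => ?_)
  obtain ⟨a, b, hab⟩ := Nat.isCoprime_iff_coprime.mpr h
  have h2 : ((a : K) * p + b * N) = 1 := by exact_mod_cast congrArg (Int.cast : ℤ → K) hab
  have hlt : ‖(a : K) * p + b * N‖ < 1 := by
    refine (IsUltrametricDist.norm_add_le_max _ _).trans_lt (max_lt ?_ ?_) <;> rw [norm_mul]
    · exact (mul_le_of_le_one_left (norm_nonneg _)
        (IsUltrametricDist.norm_intCast_le_one K a)).trans_lt hp1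
    · exact (mul_le_of_le_one_left (norm_nonneg _)
        (IsUltrametricDist.norm_intCast_le_one K b)).trans_lt hN
  rw [h2, norm_one] at hlt
  exact lt_irrefl _ hlt

theorem norm_pow_le_norm_factorial (hp : p.Prime) (hp1 : ‖(p : K)‖ < 1) (k : ℕ) :
    ‖(p : K)‖ ^ k ≤ ‖(k.factorial : K)‖ := by
  have := Fact.mk hp
  have hv : k.factorial.factorization p ≤ k := by
    rw [Nat.factorization_def _ hp]
    calc padicValNat p k.factorial ≤ (p - 1) * padicValNat p k.factorial :=
          Nat.le_mul_of_pos_left _ (Nat.sub_pos_of_lt hp.one_lt)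
      _ ≤ k := by rw [sub_one_mul_padicValNat_factorial]; exact Nat.sub_le _ _
  conv_rhs => rw [← Nat.ordProj_mul_ordCompl_eq_self k.factorial p]
  rw [Nat.cast_mul, norm_mul, Nat.cast_pow, norm_pow,
    norm_natCast_eq_one_of_coprime hp1 (Nat.coprime_ordCompl hp k.factorial_ne_zero), mul_one]
  exact pow_le_pow_of_le_one (norm_nonneg _) hp1.le hv

theorem norm_inv_factorial_mul_le (hp : p.Prime) (hp1 : ‖(p : K)‖ < 1) [CharZero K] (k : ℕ) :
    ‖((k.factorial : K))⁻¹‖ * (‖(p : K)‖ ^ 2) ^ k ≤ ‖(p : K)‖ ^ k := by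
  have h := norm_pow_le_norm_factorial (K := K) hp hp1 k
  have hpos : 0 < ‖(k.factorial : K)‖ :=
    norm_pos_iff.mpr (Nat.cast_ne_zero.mpr k.factorial_ne_zero)
  rw [norm_inv, inv_mul_le_iff₀ hpos, pow_right_comm, sq]
  exact mul_le_mul_of_nonneg_right h (by positivity)

/-- Two Tate series in one variable that agree at all natural numbers are equal. -/
theorem IsTateLE.eq_of_forall_natCast [CharZero K] (hp : p.Prime) (hp1 : ‖(p : K)‖ < 1) {r s : ℝ}
    {f g : ValRing K → K} (hf : IsTateLE r fun z : Fin 1 → ValRing K => f (z 0))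
    (hg : IsTateLE s fun z : Fin 1 → ValRing K => g (z 0))
    (h : ∀ N : ℕ, f N = g N) (t : ValRing K) : f t = g t := by
  have hsub := (hf.mono (le_max_left r s)).sub (hg.mono (le_max_right r s))
  refine sub_eq_zero.mp (hsub.eq_zero_of_tendsto_zero (u := fun k => ((p ^ k : ℕ) : ValRing K))
    ?_ (fun k => ?_) (fun k => ?_) fun _ => t)
  · simpa using tendsto_pow_atTop_nhds_zero_of_norm_lt_one hp1
  · simp [hp.ne_zero]
  · exact sub_eq_zero.mpr (h _)

variable {n : ℕ}

/-- The difference operator `g ↦ g ∘ F - g`. -/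
def compDiff {X : Type*} (F : X → X) (g : X → K) : X → K := fun x => g (F x) - g x

omit [IsUltrametricDist K] in
/-- The Gregory–Newton formula for the values of `g` along an orbit of `F`. -/
theorem apply_iterate_eq_sum_compDiff {X : Type*} (F : X → X) (g : X → K) (N : ℕ) (x : X) :
    g (F^[N] x) = ∑ k ∈ Finset.range (N + 1), (N.choose k : K) * (compDiff F)^[k] g x := by
  have h1 : ∀ k j, (fwdDiff 1)^[k] (fun j => g (F^[j] x)) j = (compDiff F)^[k] g (F^[j] x) := by
    intro k
    induction k with
    | zero => intro j; rfl
    | succ k ih =>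
      intro j
      rw [Function.iterate_succ_apply', Function.iterate_succ_apply', fwdDiff, ih, ih, compDiff,
        Function.iterate_succ_apply' F]
  have h := shift_eq_sum_fwdDiff_iter (1 : ℕ) (fun j => g (F^[j] x)) N 0
  simp only [h1, zero_add, smul_eq_mul, mul_one, nsmul_eq_mul, Function.iterate_zero, id_eq] at h
  exact h

omit [IsUltrametricDist K] in
theorem prod_range_sub_mul_inv_factorial [CharZero K] (N k : ℕ) :
    (∏ j ∈ Finset.range k, ((N : K) - j)) * (k.factorial : K)⁻¹ = N.choose k := by
  rw [← descPochhammer_eval_eq_prod_range, descPochhammer_eval_eq_descFactorial,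
    Nat.descFactorial_eq_factorial_mul_choose, Nat.cast_mul, mul_right_comm,
    mul_inv_cancel₀ (Nat.cast_ne_zero.mpr k.factorial_ne_zero), one_mul]

variable [CompleteSpace K]

theorem IsTateLE.iterate_compDiff {ε : ℝ} (hε : 0 ≤ ε)
    {F : (Fin n → ValRing K) → Fin n → ValRing K} (hF1 : ∀ i, IsTateLE 1 fun x => (F x i : K))
    (hF : ∀ i, IsTateLE ε fun x => (F x i : K) - x i) {g : (Fin n → ValRing K) → K}
    (hg : IsTateLE 1 g) (k : ℕ) : IsTateLE (ε ^ k) ((compDiff F)^[k] g) := by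
  induction k with
  | zero => simpa using hg
  | succ k ih =>
    rw [Function.iterate_succ_apply', pow_succ]
    exact ih.comp_sub hF1 hε hF

omit [CompleteSpace K] in
theorem IsTateLE.of_sub_coord {ε : ℝ} (hε : ε ≤ 1) {F : (Fin n → ValRing K) → K} {i : Fin n}
    (hF : IsTateLE ε fun x => F x - x i) : IsTateLE 1 F := by
  simpa using (hF.mono hε).add (isTateLE_coord i)

/-- A Tate map that is congruent to the identity modulo `p ^ 2` embeds in an analytic flow,
parametrized by the valuation ring. The flow is the binomial series of the difference operator
`Δ : g ↦ g ∘ F - g`, namely `∑ k, (t choose k) Δ ^ k`; as `Δ` multiplies Gauss norms by at most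
`‖p‖ ^ 2`, this outweighs the denominators `k!`. -/
theorem exists_flow [CharZero K] (hp : p.Prime) (hp1 : ‖(p : K)‖ < 1)
    {F : (Fin n → ValRing K) → Fin n → ValRing K}
    (hF : ∀ i, IsTateLE (‖(p : K)‖ ^ 2) fun x => (F x i : K) - x i) :
    ∃ Φ : ValRing K → (Fin n → ValRing K) → Fin n → ValRing K,
      (∀ i, IsTateLE 1 fun z : Fin (n + 1) → ValRing K => (Φ (z 0) (Fin.tail z) i : K)) ∧
      (∀ s t x, Φ (s + t) x = Φ s (Φ t x)) ∧ ∀ (N : ℕ) x, Φ N x = F^[N] x := by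
  have hp2 : ‖(p : K)‖ ^ 2 ≤ 1 := pow_le_one₀ (norm_nonneg _) hp1.le
  have hF1 : ∀ i, IsTateLE 1 fun x => (F x i : K) := fun i => (hF i).of_sub_coord hp2
  let T : Fin n → ℕ → (Fin (n + 1) → ValRing K) → K := fun i k z =>
    (∏ j ∈ Finset.range k, ((z 0 : K) - (j : K))) * (k.factorial : K)⁻¹ *
      (compDiff F)^[k] (fun x => (x i : K)) (Fin.tail z)
  have hT : ∀ i k, IsTateLE (‖(p : K)‖ ^ k) (T i k) := by
    intro i k
    have h1 : IsTateLE 1 fun z : Fin (n + 1) → ValRing K =>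
        ∏ j ∈ Finset.range k, ((z 0 : K) - (j : K)) := IsTateLE.prod _ fun j _ =>
      (isTateLE_coord 0).sub
        ((isTateLE_const (j : K)).mono (IsUltrametricDist.norm_natCast_le_one K j))
    have h2 := (IsTateLE.iterate_compDiff (by positivity) hF1 hF (isTateLE_coord i) k).comp
      (G := fun z : Fin (n + 1) → ValRing K => Fin.tail z) fun j => isTateLE_coord j.succ
    have h3 := (h1.mul (h2.const_mul (k.factorial : K)⁻¹)).mono
      ((one_mul _).trans_le (norm_inv_factorial_mul_le hp hp1 k))
    simpa only [T, mul_assoc] using h3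
  have htend : Tendsto (fun k : ℕ => ‖(p : K)‖ ^ k) cofinite (𝓝 0) := by
    rw [Nat.cofinite_eq_atTop]
    exact tendsto_pow_atTop_nhds_zero_of_lt_one (norm_nonneg _) hp1
  have hsum : ∀ i z, HasSum (fun k => T i k z) (∑' k, T i k z) := fun i z =>
    (summable_of_norm_le (fun k => (hT i k).norm_le z) htend).hasSum
  have hS : ∀ i, IsTateLE 1 fun z => ∑' k, T i k z := fun i =>
    IsTateLE.of_hasSum (hT i) htend zero_le_one
      (fun k => pow_le_one₀ (norm_nonneg _) hp1.le) (hsum i)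
  let Φ : ValRing K → (Fin n → ValRing K) → Fin n → ValRing K := fun t x i =>
    ⟨∑' k, T i k (Fin.cons t x), mem_valRing_iff.mpr ((hS i).norm_le _)⟩
  have hΦ : ∀ i, IsTateLE 1 fun z : Fin (n + 1) → ValRing K => (Φ (z 0) (Fin.tail z) i : K) := by
    intro i
    simpa [Φ] using hS i
  have hΦN : ∀ (N : ℕ) x, Φ N x = F^[N] x := by
    intro N x
    funext i
    refine Subtype.ext ?_
    rw [apply_iterate_eq_sum_compDiff F (fun x : Fin n → ValRing K => (x i : K)) N x]
    have hval : ∀ k, T i k (Fin.cons (N : ValRing K) x) =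
        (N.choose k : K) * (compDiff F)^[k] (fun x => (x i : K)) x := by
      intro k
      simp only [T, Fin.cons_zero, Fin.tail_cons, ← prod_range_sub_mul_inv_factorial (K := K) N k]
      simp
    change ∑' k, T i k (Fin.cons (N : ValRing K) x) = _
    simp only [hval]
    refine tsum_eq_sum fun k hk => ?_
    rw [Nat.choose_eq_zero_of_lt (by simpa using hk)]
    simp
  have hΦt : ∀ x i, IsTateLE 1 fun z : Fin 1 → ValRing K => (Φ (z 0) x i : K) := by
    intro x i
    have h := (hΦ i).comp (G := fun z : Fin 1 → ValRing K => Fin.cons (z 0) x) fun j => by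
      refine Fin.cases ?_ (fun j => ?_) j
      · simpa using isTateLE_coord (K := K) (0 : Fin 1)
      · simpa using (isTateLE_const (n := 1) (x j : K)).mono (norm_coe_le_one (x j))
    simpa using h
  have hΦt' : ∀ x i (a : ValRing K),
      IsTateLE 1 fun z : Fin 1 → ValRing K => (Φ (z 0 + a) x i : K) := by
    intro x i a
    refine (hΦt x i).comp (G := fun z _ => z 0 + a) fun _ => ?_
    simpa using (isTateLE_coord (K := K) (0 : Fin 1)).add
      ((isTateLE_const (a : K)).mono (norm_coe_le_one a))
  -- both sides are analytic in `t` and agree at the natural numbers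
  have hstep : ∀ t x, Φ (t + 1) x = F (Φ t x) := by
    intro t x
    funext i
    refine Subtype.ext (IsTateLE.eq_of_forall_natCast hp hp1 (f := fun t => (Φ (t + 1) x i : K))
      (g := fun t => (F (Φ t x) i : K)) (hΦt' x i 1) ((hF1 i).comp (hΦt x)) (fun N => ?_) t)
    have h := hΦN (N + 1) x
    rw [Nat.cast_succ] at h
    rw [h, hΦN, Function.iterate_succ_apply']
  have hstepN : ∀ (N : ℕ) t x, Φ (N + t) x = F^[N] (Φ t x) := by
    intro N t x
    induction N with
    | zero => simp
    | succ N ih =>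
      rw [Function.iterate_succ_apply', ← ih, ← hstep, Nat.cast_succ]
      congr 1
      ring
  refine ⟨Φ, hΦ, fun s t x => ?_, hΦN⟩
  -- for fixed `t`, both sides are analytic in `s` and agree at the natural numbers
  funext i
  refine Subtype.ext (IsTateLE.eq_of_forall_natCast hp hp1 (f := fun s => (Φ (s + t) x i : K))
    (g := fun s => (Φ s (Φ t x) i : K)) (hΦt' x i t) (hΦt (Φ t x) i) (fun N => ?_) s)
  rw [hstepN, hΦN]

end

/-! ### The tangent space of a smooth scheme at a rational point -/

section SmoothPoint

variable {k : Type u} [Field k] {N : ℕ}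

/-- The differential at the origin of a polynomial `h`, as the vector of its partial derivatives. -/
noncomputable def diffZero (h : MvPolynomial (Fin N) k) (i : Fin N) : k :=
  MvPolynomial.constantCoeff (MvPolynomial.pderiv i h)

theorem diffZero_eq_coeff (h : MvPolynomial (Fin N) k) (i : Fin N) :
    diffZero h i = MvPolynomial.coeff (Finsupp.single i 1) h := by
  classical
  induction h using MvPolynomial.induction_on' with
  | monomial s a =>
    rw [diffZero, MvPolynomial.pderiv_monomial, MvPolynomial.constantCoeff_eq,
      MvPolynomial.coeff_monomial, MvPolynomial.coeff_monomial]
    by_cases hs : s = Finsupp.single i 1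
    · subst hs; simp
    · rw [if_neg hs]
      by_cases h0 : s i = 0
      · simp [h0]
      · rw [if_neg]
        intro h1
        apply hs
        ext j
        have h2 := DFunLike.congr_fun h1 j
        simp only [Finsupp.coe_tsub, Pi.sub_apply, Finsupp.coe_zero, Pi.zero_apply] at h2
        by_cases hj : i = j
        · subst hj
          simp at h2 ⊢
          omega
        · simp [hj] at h2 ⊢
          exact h2
  | add p q hp hq => simp [diffZero] at *; rw [hp, hq]

theorem diffZero_add (f g : MvPolynomial (Fin N) k) :
    diffZero (f + g) = diffZero f + diffZero g := by
  ext i; simp [diffZero]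

theorem diffZero_sub (f g : MvPolynomial (Fin N) k) :
    diffZero (f - g) = diffZero f - diffZero g := by
  ext i; simp [diffZero]

theorem diffZero_C_mul (c : k) (g : MvPolynomial (Fin N) k) :
    diffZero (MvPolynomial.C c * g) = c • diffZero g := by
  ext i; simp [diffZero]

theorem diffZero_mul (f g : MvPolynomial (Fin N) k) : diffZero (f * g) =
    MvPolynomial.constantCoeff f • diffZero g + MvPolynomial.constantCoeff g • diffZero f := by
  ext i; simp [diffZero]

variable {S : Type u} [CommRing S] [Algebra k S] {a : Fin N → S}

/-- If `S` is formally smooth over `k` with presentation ideal `I` and the origin lies on `Spec S`,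
an element of `I` whose differential vanishes at the origin lies in `𝔪 I`. -/
theorem mem_smul_ker_of_diffZero_eq_zero [Algebra.FormallySmooth k S]
    (ha : Function.Surjective (MvPolynomial.aeval a : MvPolynomial (Fin N) k →ₐ[k] S))
    (hI : RingHom.ker (MvPolynomial.aeval a : MvPolynomial (Fin N) k →ₐ[k] S) ≤
      RingHom.ker (MvPolynomial.constantCoeff : MvPolynomial (Fin N) k →+* k))
    {h : MvPolynomial (Fin N) k}
    (hh : h ∈ RingHom.ker (MvPolynomial.aeval a : MvPolynomial (Fin N) k →ₐ[k] S))
    (hd : diffZero h = 0) :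
    h ∈ RingHom.ker (MvPolynomial.constantCoeff : MvPolynomial (Fin N) k →+* k) •
      RingHom.ker (MvPolynomial.aeval a : MvPolynomial (Fin N) k →ₐ[k] S) := by
  let _ : Algebra (MvPolynomial (Fin N) k) S := (MvPolynomial.aeval a).toRingHom.toAlgebra
  have : IsScalarTower k (MvPolynomial (Fin N) k) S :=
    IsScalarTower.of_algebraMap_eq' (MvPolynomial.aeval a).comp_algebraMap.symm
  let I : Ideal (MvPolynomial (Fin N) k) := RingHom.ker (algebraMap (MvPolynomial (Fin N) k) S)
  obtain ⟨l, hl⟩ := (Algebra.FormallySmooth.iff_split_injection (R := k)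
    (P := MvPolynomial (Fin N) k) (A := S) ha).mp inferInstance
  change h ∈ I at hh
  change h ∈ RingHom.ker (MvPolynomial.constantCoeff : MvPolynomial (Fin N) k →+* k) • I
  -- a retraction `l` of `I / I ^ 2 → S ⊗ Ω` expresses the class of `h` by its partial derivatives,
  -- which lie in `𝔪`
  have hD : KaehlerDifferential.D k _ h = ∑ i, MvPolynomial.pderiv i h •
      KaehlerDifferential.D k (MvPolynomial (Fin N) k) (MvPolynomial.X i) := by
    have := (KaehlerDifferential.mvPolynomialBasis k (Fin N)).sum_repr
      (KaehlerDifferential.D k _ h)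
    rw [← this]
    refine Finset.sum_congr rfl fun i _ => ?_
    rw [KaehlerDifferential.mvPolynomialBasis_repr_apply,
      KaehlerDifferential.mvPolynomialBasis_apply]
  choose v hv using fun i : Fin N => I.toCotangent_surjective
    (l (1 ⊗ₜ KaehlerDifferential.D k (MvPolynomial (Fin N) k) (MvPolynomial.X i)))
  have h1 : I.toCotangent ⟨h, hh⟩ = I.toCotangent (∑ i, MvPolynomial.pderiv i h • v i) := by
    have h2 := LinearMap.congr_fun hl (I.toCotangent ⟨h, hh⟩)
    rw [LinearMap.comp_apply, KaehlerDifferential.kerCotangentToTensor_toCotangent,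
      LinearMap.id_apply] at h2
    rw [← h2, map_sum, hD, TensorProduct.tmul_sum, map_sum]
    refine Finset.sum_congr rfl fun i _ => ?_
    rw [TensorProduct.tmul_smul, map_smul, map_smul, hv]
  rw [← sub_eq_zero, ← map_sub, Ideal.toCotangent_eq_zero] at h1
  have h3 : ((∑ i, MvPolynomial.pderiv i h • v i : I) : MvPolynomial (Fin N) k) ∈
      RingHom.ker (MvPolynomial.constantCoeff : MvPolynomial (Fin N) k →+* k) • I := by
    rw [Submodule.coe_sum]
    refine Submodule.sum_mem _ fun i _ => Submodule.smul_mem_smul ?_ (v i).2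
    exact congrFun hd i
  have h4 : I ^ 2 ≤
      RingHom.ker (MvPolynomial.constantCoeff : MvPolynomial (Fin N) k →+* k) • I := by
    rw [sq, smul_eq_mul]
    exact Ideal.mul_mono_left hI
  have h5 := Submodule.add_mem _ (h4 h1) h3
  simpa using h5

/-- The Zariski tangent space at the origin of the subscheme of affine space defined by `I`. -/
noncomputable def tangentZero (I : Ideal (MvPolynomial (Fin N) k)) : Submodule k (Fin N → k) where
  carrier := {v | ∀ h ∈ I, ∑ i, diffZero h i * v i = 0}
  add_mem' hv hw h hh := by simp [mul_add, Finset.sum_add_distrib, hv h hh, hw h hh]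
  zero_mem' h _ := by simp
  smul_mem' c v hv h hh := by
    have := congrArg (c * ·) (hv h hh)
    simpa [Finset.mul_sum, mul_left_comm] using this

/-- The cotangent space at a rational point of a standard smooth scheme of relative dimension `m`
has dimension `m`. Here `k` is an `S`-algebra through the point. -/
theorem finrank_tensor_kaehlerDifferential [Algebra S k] [IsScalarTower k S k]
    {m : ℕ} {g : S} (hg : algebraMap S k g ≠ 0)
    (hsm : Algebra.IsStandardSmoothOfRelativeDimension m k (Localization.Away g)) :
    Module.finrank k (k ⊗[S] Ω[S⁄k]) = m := by
  let B := Localization.Away g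
  let _ : Algebra B k := (IsLocalization.Away.lift (S := B) g (g := algebraMap S k)
    (isUnit_iff_ne_zero.mpr hg)).toAlgebra
  have : IsScalarTower S B k := IsScalarTower.of_algebraMap_eq fun s =>
    (IsLocalization.Away.lift_eq g (isUnit_iff_ne_zero.mpr hg) s).symm
  have : Nontrivial B := (algebraMap B k).domain_nontrivial
  have : Algebra.FormallyEtale S B := Algebra.FormallyEtale.of_isLocalization (Submonoid.powers g)
  have : Algebra.IsStandardSmooth k B := hsm.isStandardSmooth m
  have h1 : Module.finrank B Ω[B⁄k] = m := Module.finrank_eq_of_rank_eq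
    (Algebra.IsStandardSmoothOfRelativeDimension.rank_kaehlerDifferential m)
  rw [← h1, ← (KaehlerDifferential.tensorKaehlerEquivOfFormallyEtale k S B).finrank_eq,
    ← (TensorProduct.AlgebraTensorModule.cancelBaseChange S B k k Ω[S⁄k]).finrank_eq]
  have : Module.Free B (B ⊗[S] Ω[S⁄k]) :=
    .of_equiv (KaehlerDifferential.tensorKaehlerEquivOfFormallyEtale k S B).symm
  exact Module.finrank_baseChange

/-- The tangent space at the origin, identified with the space of derivations `S → k` and hence with
the dual of the cotangent space, has dimension `m`. -/
theorem finrank_tangentZero (ε : S →ₐ[k] k) (hε : ∀ i, ε (a i) = 0)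
    (ha : Function.Surjective (MvPolynomial.aeval a : MvPolynomial (Fin N) k →ₐ[k] S))
    {m : ℕ} {g : S} (hg : ε g ≠ 0)
    (hsm : Algebra.IsStandardSmoothOfRelativeDimension m k (Localization.Away g)) :
    Module.finrank k (tangentZero
      (RingHom.ker (MvPolynomial.aeval a : MvPolynomial (Fin N) k →ₐ[k] S))) = m := by
  let _ : Algebra S k := ε.toRingHom.toAlgebra
  have : IsScalarTower k S k := IsScalarTower.of_algebraMap_eq fun s => (ε.commutes s).symm
  have hεmap : ∀ s, algebraMap S k s = ε s := fun _ => rfl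
  have hεP : ∀ h : MvPolynomial (Fin N) k, ε (MvPolynomial.aeval a h) =
      MvPolynomial.constantCoeff h := by
    intro h
    rw [← AlgHom.comp_apply, MvPolynomial.comp_aeval]
    simp [hε, MvPolynomial.aeval_zero']
  have hder : ∀ (D : Derivation k S k) (h : MvPolynomial (Fin N) k),
      D (MvPolynomial.aeval a h) = ∑ i, diffZero h i * D (a i) := by
    intro D h
    induction h using MvPolynomial.induction_on with
    | C c => simp [diffZero]
    | add f g hf hg => simp [hf, hg, diffZero_add, add_mul, Finset.sum_add_distrib]
    | mul_X f i hf =>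
      rw [map_mul, Derivation.leibniz, hf, MvPolynomial.aeval_X, diffZero_mul]
      simp only [Algebra.smul_def, hεmap, hεP, hε, zero_mul, add_zero,
        MvPolynomial.constantCoeff_X, Pi.add_apply]
      rw [Finset.sum_eq_single i]
      · simp [diffZero]
      · intro j _ hj
        simp [diffZero, MvPolynomial.pderiv_X_of_ne hj.symm]
      · simp
  rw [← finrank_tensor_kaehlerDifferential (k := k) (S := S) hg hsm,
    ← Subspace.dual_finrank_eq (V := k ⊗[S] Ω[S⁄k])]
  symm
  let D' : Module.Dual k (k ⊗[S] Ω[S⁄k]) → Derivation k S k := fun θ =>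
    ((θ.restrictScalars S).comp (TensorProduct.mk S k Ω[S⁄k] 1)).compDer (KaehlerDifferential.D k S)
  have hD' : ∀ θ s, D' θ s = θ (1 ⊗ₜ KaehlerDifferential.D k S s) := fun _ _ => rfl
  let Θ : Module.Dual k (k ⊗[S] Ω[S⁄k]) →ₗ[k] (Fin N → k) :=
    { toFun := fun θ i => D' θ (a i)
      map_add' := fun θ η => by ext i; simp [hD']
      map_smul' := fun c θ => by ext i; simp [hD'] }
  have hΘ : ∀ θ i, Θ θ i = D' θ (a i) := fun _ _ => rfl
  have hinj : Function.Injective Θ := by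
    rw [← LinearMap.ker_eq_bot, LinearMap.ker_eq_bot']
    intro θ hθ
    have h1 : ∀ s, D' θ s = 0 := by
      intro s
      obtain ⟨h, rfl⟩ := ha s
      rw [hder]
      exact Finset.sum_eq_zero fun i _ => by rw [← hΘ, hθ]; simp
    have h2 : ∀ ω, θ (1 ⊗ₜ ω) = 0 := by
      intro ω
      have hω : ω ∈ Submodule.span S (Set.range (KaehlerDifferential.D k S)) := by
        rw [KaehlerDifferential.span_range_derivation]; trivial
      induction hω using Submodule.span_induction with
      | mem x hx => obtain ⟨s, rfl⟩ := hx; exact h1 s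
      | zero => simp
      | add x y _ _ hx hy => rw [TensorProduct.tmul_add, map_add, hx, hy, add_zero]
      | smul s x _ hx =>
        have : (1 : k) ⊗ₜ[S] (s • x) = (algebraMap S k s) • ((1 : k) ⊗ₜ[S] x) := by
          rw [TensorProduct.tmul_smul, algebraMap_smul]
        rw [this, map_smul, hx, smul_zero]
    refine LinearMap.ext fun x => ?_
    induction x using TensorProduct.induction_on with
    | zero => simp
    | tmul c ω =>
      have : c ⊗ₜ[S] ω = c • ((1 : k) ⊗ₜ[S] ω) := by simp [TensorProduct.smul_tmul']
      rw [this, map_smul, h2]; simp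
    | add x y hx hy => simpa [hx] using hy
  have hrange : LinearMap.range Θ = tangentZero
      (RingHom.ker (MvPolynomial.aeval a : MvPolynomial (Fin N) k →ₐ[k] S)) := by
    ext v
    constructor
    · rintro ⟨θ, rfl⟩ h hh
      have := hder (D' θ) h
      rw [(RingHom.mem_ker).mp hh, map_zero] at this
      simpa [hΘ] using this.symm
    · intro hv
      have hwd : ∀ f g : MvPolynomial (Fin N) k, MvPolynomial.aeval a f = MvPolynomial.aeval a g →
          ∑ i, diffZero f i * v i = ∑ i, diffZero g i * v i := by
        intro f g hfg
        have := hv (f - g) (by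
          change MvPolynomial.aeval a (f - g) = 0
          rw [map_sub, hfg, sub_self])
        simpa [diffZero_sub, sub_mul, sub_eq_zero] using this
      let σ := Function.surjInv ha
      have hσ : ∀ s, MvPolynomial.aeval a (σ s) = s := Function.surjInv_eq ha
      let δ₀ : S →ₗ[k] k :=
        { toFun := fun s => ∑ i, diffZero (σ s) i * v i
          map_add' := fun s t => by
            rw [hwd (σ (s + t)) (σ s + σ t) (by simp [hσ])]
            simp [diffZero_add, add_mul, Finset.sum_add_distrib]
          map_smul' := fun c s => by
            rw [hwd (σ (c • s)) (MvPolynomial.C c * σ s) (by simp [hσ, Algebra.smul_def])]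
            simp [diffZero_C_mul, mul_assoc, Finset.mul_sum] }
      let δ : Derivation k S k := Derivation.mk' δ₀ fun s t => by
        change ∑ i, diffZero (σ (s * t)) i * v i = s • ∑ i, diffZero (σ t) i * v i +
          t • ∑ i, diffZero (σ s) i * v i
        have hc : ∀ s, MvPolynomial.constantCoeff (σ s) = algebraMap S k s := fun s => by
          rw [← hεP, hσ, hεmap]
        rw [hwd (σ (s * t)) (σ s * σ t) (by simp [hσ]), diffZero_mul, hc, hc]
        simp [Algebra.smul_def, add_mul, Finset.sum_add_distrib, Finset.mul_sum, mul_assoc]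
      refine ⟨LinearMap.liftBaseChange k δ.liftKaehlerDifferential, ?_⟩
      ext i
      rw [hΘ, hD', LinearMap.liftBaseChange_tmul, one_smul,
        Derivation.liftKaehlerDifferential_comp_D]
      change ∑ j, diffZero (σ (a i)) j * v j = v i
      rw [hwd _ (MvPolynomial.X i) (by simp [hσ]), Finset.sum_eq_single i]
      · simp [diffZero]
      · intro j _ hj
        simp [diffZero, MvPolynomial.pderiv_X_of_ne hj.symm]
      · simp
  rw [← hrange]
  exact (LinearEquiv.ofInjective Θ hinj).finrank_eq

end SmoothPoint

/-! ### Local equations at a smooth point -/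

section SmoothPoint

variable {k : Type u} [Field k] {N : ℕ} {S : Type u} [CommRing S] [Algebra k S]

theorem formallySmooth_of_smoothOfRelativeDimension {m : ℕ}
    (hV : AlgebraicGeometry.SmoothOfRelativeDimension m (AlgebraicGeometry.Spec.map
      (CommRingCat.ofHom (algebraMap k S)))) : Algebra.FormallySmooth k S := by
  have h := hV.smooth
  rw [AlgebraicGeometry.HasRingHomProperty.Spec_iff (P := @AlgebraicGeometry.Smooth)] at h
  have h2 : Algebra.Smooth k S := RingHom.smooth_algebraMap.mp h
  exact h2.formallySmooth

theorem exists_isStandardSmooth_away {m : ℕ}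
    (hV : AlgebraicGeometry.SmoothOfRelativeDimension m (AlgebraicGeometry.Spec.map
      (CommRingCat.ofHom (algebraMap k S)))) (ε : S →ₐ[k] k) :
    ∃ g : S, ε g ≠ 0 ∧
      Algebra.IsStandardSmoothOfRelativeDimension m k (Localization.Away g) := by
  rw [AlgebraicGeometry.HasRingHomProperty.Spec_iff
    (P := @AlgebraicGeometry.SmoothOfRelativeDimension m)] at hV
  obtain ⟨s, hs, h⟩ := hV
  have : ∃ g ∈ s, ε g ≠ 0 := by
    by_contra! hcon
    have h1 : Ideal.span s ≤ RingHom.ker ε := Ideal.span_le.mpr fun g hg => hcon g hg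
    rw [hs, top_le_iff, Ideal.eq_top_iff_one, RingHom.mem_ker, map_one] at h1
    exact one_ne_zero h1
  obtain ⟨g, hgs, hg⟩ := this
  refine ⟨g, hg, ?_⟩
  have h2 := h g hgs
  rw [← RingHom.isStandardSmoothOfRelativeDimension_algebraMap]
  exact h2

open scoped Pointwise in
/-- Local equations and a linear splitting at the origin of a smooth affine scheme: finitely many
elements `f` of the ideal `I` that generate it locally, as witnessed by `g`, and whose differentials
are linearly independent, vectors `v` dual to these differentials, a basis `τ` of the tangent space,
and the coordinates `b` with respect to `τ` along `v`. -/
theorem exists_local_equations {a : Fin N → S} {m : ℕ}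
    (hV : AlgebraicGeometry.SmoothOfRelativeDimension m (AlgebraicGeometry.Spec.map
      (CommRingCat.ofHom (algebraMap k S)))) (ε : S →ₐ[k] k) (hε : ∀ i, ε (a i) = 0)
    (ha : Function.Surjective (MvPolynomial.aeval a : MvPolynomial (Fin N) k →ₐ[k] S)) :
    ∃ (c : ℕ) (f : Fin c → MvPolynomial (Fin N) k) (g : MvPolynomial (Fin N) k)
      (v : Fin c → Fin N → k) (τ : Fin m → Fin N → k) (b : Fin m → (Fin N → k) →ₗ[k] k),
      (∀ i, MvPolynomial.aeval a (f i) = 0) ∧ MvPolynomial.constantCoeff g = 1 ∧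
      (∀ h, MvPolynomial.aeval a h = 0 → g * h ∈ Ideal.span (Set.range f)) ∧
      (∀ i j, ∑ l, diffZero (f i) l * v j l = if i = j then 1 else 0) ∧
      (∀ i j, ∑ l, diffZero (f i) l * τ j l = 0) ∧
      (∀ i j, b i (τ j) = if i = j then 1 else 0) ∧ (∀ i j, b i (v j) = 0) ∧
      ∀ w : Fin N → k, (∀ i, ∑ l, diffZero (f i) l * w l = 0) → w = ∑ j, b j w • τ j := by
  have hfs := formallySmooth_of_smoothOfRelativeDimension hV
  obtain ⟨g₀, hg₀, hsm⟩ := exists_isStandardSmooth_away hV ε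
  have hT := finrank_tangentZero ε hε ha hg₀ hsm
  set I := RingHom.ker (MvPolynomial.aeval a : MvPolynomial (Fin N) k →ₐ[k] S) with hI
  let 𝔪 := RingHom.ker (MvPolynomial.constantCoeff : MvPolynomial (Fin N) k →+* k)
  have hI𝔪 : I ≤ 𝔪 := by
    intro h hh
    have h1 : ε (MvPolynomial.aeval a h) = MvPolynomial.constantCoeff h := by
      rw [← AlgHom.comp_apply, MvPolynomial.comp_aeval]
      simp [hε, MvPolynomial.aeval_zero']
    rw [RingHom.mem_ker.mp hh, map_zero] at h1
    exact h1.symm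
  let d : MvPolynomial (Fin N) k →ₗ[k] (Fin N → k) :=
    { toFun := diffZero
      map_add' := diffZero_add
      map_smul' := fun c h => by rw [MvPolynomial.smul_eq_C_mul, diffZero_C_mul]; rfl }
  let W : Submodule k (Fin N → k) := (I.restrictScalars k).map d
  let w := Module.finBasis k W
  have hw : ∀ i, ∃ f ∈ I, diffZero f = (w i : Fin N → k) := fun i => (w i).2
  choose f hfI hfw using hw
  have hli : LinearIndependent k (Matrix.of fun i => diffZero (f i)).row := by
    have h1 : LinearIndependent k fun i => (w i : Fin N → k) :=
      w.linearIndependent.map' W.subtype W.ker_subtype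
    convert! h1 using 2 with i
    exact hfw i
  let L : (Fin N → k) →ₗ[k] (Fin (Module.finrank k W) → k) :=
    (Matrix.of fun i => diffZero (f i)).mulVecLin
  have hL : ∀ v i, L v i = ∑ l, diffZero (f i) l * v l := fun _ _ => rfl
  have hLsurj : LinearMap.range L = ⊤ := by
    apply Submodule.eq_top_of_finrank_eq
    have := hli.rank_matrix
    rw [Matrix.rank] at this
    rw [this]
    simp
  -- a section `R` of the differentials `L` splits the affine space as `ker L ⊕ range R`, and the
  -- kernel of `L` is the tangent space
  obtain ⟨R, hR⟩ := L.exists_rightInverse_of_surjective hLsurj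
  have hLR : ∀ x, L (R x) = x := fun x => LinearMap.congr_fun hR x
  have hexp : ∀ h ∈ I, ∃ q : Fin (Module.finrank k W) → k,
      diffZero h = ∑ i, q i • diffZero (f i) := by
    intro h hh
    have h1 := w.sum_repr ⟨diffZero h, h, hh, rfl⟩
    refine ⟨fun i => w.repr ⟨diffZero h, h, hh, rfl⟩ i, ?_⟩
    have h2 := congrArg (Subtype.val : W → Fin N → k) h1
    simp only [Submodule.coe_sum, Submodule.coe_smul, ← hfw] at h2
    exact h2.symm
  have hkerL : ∀ v, L v = 0 → v ∈ tangentZero I := by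
    intro v hv h hh
    obtain ⟨q, hq⟩ := hexp h hh
    simp only [hq, Finset.sum_apply, Pi.smul_apply, smul_eq_mul, Finset.sum_mul]
    rw [Finset.sum_comm]
    refine Finset.sum_eq_zero fun i _ => ?_
    have := congrFun hv i
    rw [hL] at this
    simp only [mul_assoc, ← Finset.mul_sum, this, Pi.zero_apply, mul_zero]
  have hTL : ∀ v ∈ tangentZero I, L v = 0 := fun v hv => funext fun i => hv _ (hfI i)
  let τ : Module.Basis (Fin m) k (tangentZero I) := Module.finBasisOfFinrankEq _ _ hT
  let pr : (Fin N → k) →ₗ[k] tangentZero I :=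
    (LinearMap.id - R ∘ₗ L).codRestrict _ fun v => hkerL _ (by simp [hLR])
  have hpr : ∀ v, L v = 0 → (pr v : Fin N → k) = v := fun v hv => by
    simp [pr, hv]
  have hprT : ∀ v : tangentZero I, pr v = v := fun v => Subtype.ext (hpr v (hTL v v.2))
  have hNak : ∃ r : MvPolynomial (Fin N) k, r - 1 ∈ 𝔪 ∧
      r • (I : Submodule (MvPolynomial (Fin N) k) (MvPolynomial (Fin N) k)) ≤
        Ideal.span (Set.range f) := by
    refine Submodule.exists_sub_one_mem_and_smul_le_of_fg_of_le_sup
      (IsNoetherian.noetherian I) le_rfl ?_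
    intro h hh
    obtain ⟨q, hq⟩ := hexp h hh
    have h1 : ∑ i, MvPolynomial.C (q i) * f i ∈ Ideal.span (Set.range f) :=
      Submodule.sum_mem _ fun i _ => Ideal.mul_mem_left _ _ (Ideal.subset_span ⟨i, rfl⟩)
    have h2 : ∑ i, MvPolynomial.C (q i) * f i ∈ I :=
      Submodule.sum_mem _ fun i _ => Ideal.mul_mem_left _ _ (hfI i)
    -- the difference has zero differential at the origin
    have h3 : h - ∑ i, MvPolynomial.C (q i) * f i ∈ 𝔪 • I := by
      refine mem_smul_ker_of_diffZero_eq_zero ha hI𝔪 (Submodule.sub_mem _ hh h2) ?_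
      have h4 : diffZero (∑ i, MvPolynomial.C (q i) * f i) = ∑ i, q i • diffZero (f i) := by
        change d _ = _
        rw [map_sum]
        exact Finset.sum_congr rfl fun i _ => diffZero_C_mul _ _
      rw [diffZero_sub, h4, hq, sub_self]
    have h5 := Submodule.add_mem_sup h1 h3
    rwa [add_sub_cancel] at h5
  obtain ⟨g, hg1, hg2⟩ := hNak
  refine ⟨_, f, g, fun j => R (Pi.single j 1), fun j => (τ j : Fin N → k),
    fun j => τ.coord j ∘ₗ pr, fun i => hfI i, ?_, fun h hh => ?_, fun i j => ?_,
    fun i j => ?_, fun i j => ?_, fun i j => ?_, fun v hv => ?_⟩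
  · have h1 : MvPolynomial.constantCoeff (g - 1) = 0 := hg1
    rwa [map_sub, map_one, sub_eq_zero] at h1
  · exact hg2 (Submodule.smul_mem_pointwise_smul h g I hh)
  · rw [← hL, hLR, Pi.single_apply]
  · rw [← hL, hTL _ (τ j).2]; rfl
  · simp [hprT, Finsupp.single_apply, eq_comm]
  · have : pr (R (Pi.single j 1)) = 0 := Subtype.ext (by simp [pr, hLR])
    simp [this]
  · have h1 : L v = 0 := funext hv
    have h2 := congrArg Subtype.val (τ.sum_repr (pr v))
    rw [hpr v h1, Submodule.coe_sum] at h2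
    exact h2.symm

end SmoothPoint

/-! ### Local parametrization of the zeros of a polynomial system -/

section

variable {K : Type u} [NontriviallyNormedField K] [IsUltrametricDist K] {n m N : ℕ}

omit [IsUltrametricDist K] in
theorem exists_forall_norm_le {ι κ : Type*} [Finite ι] [Finite κ] (c : ι → κ → K) :
    ∃ B : ℝ, 0 ≤ B ∧ ∀ i j, ‖c i j‖ ≤ B := by
  obtain ⟨B, hB⟩ := (Set.finite_range fun q : ι × κ => ‖c q.1 q.2‖).bddAbove
  exact ⟨max B 0, le_max_right _ _, fun i j => (hB ⟨(i, j), rfl⟩).trans (le_max_left _ _)⟩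

theorem eq_zero_or_eq_single_or_two_le {ι : Type*} [Fintype ι] (I : ι →₀ ℕ) :
    I = 0 ∨ (∃ i, I = Finsupp.single i 1) ∨ 2 ≤ ∑ i, I i := by
  classical
  by_cases hI : I = 0
  · exact Or.inl hI
  refine Or.inr ?_
  obtain ⟨i, hi⟩ : ∃ i, I i ≠ 0 := by
    by_contra! hcon
    exact hI (Finsupp.ext hcon)
  refine (Nat.lt_or_ge (∑ i, I i) 2).imp (fun h => ⟨i, ?_⟩) id
  have h3 := Finset.add_sum_erase Finset.univ I (Finset.mem_univ i)
  have h4 : ∑ j ∈ Finset.univ.erase i, I j = 0 := by omega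
  have h5 : I i = 1 := by omega
  ext j
  by_cases hj : j = i
  · subst hj; simpa using h5
  · rw [Finsupp.single_eq_of_ne hj]
    exact (Finset.sum_eq_zero_iff.mp h4) j (by simp [hj])

/-- Restriction of a Tate series to a smaller polydisk: the coefficient of a monomial of degree `d`
is multiplied by the `d`-th power of the radius `‖s‖`. -/
theorem isTateLE_comp_smul {c : (Fin n →₀ ℕ) → K} {F : (Fin n → ValRing K) → K} {ρ C : ℝ}
    (hc : Tendsto c cofinite (𝓝 0))
    (hF : ∀ x, HasSum (fun I => c I * ∏ i, (x i : K) ^ I i) (F x)) (s : ValRing K)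
    (h0 : ‖c 0‖ ≤ ρ) (h1 : ∀ i, ‖c (Finsupp.single i 1)‖ * ‖(s : K)‖ ≤ ρ)
    (hC : ∀ I, ‖c I‖ ≤ C) (h2 : C * ‖(s : K)‖ ^ 2 ≤ ρ) :
    IsTateLE ρ fun x => F (fun i => s * x i) := by
  have hs := norm_coe_le_one s
  refine ⟨fun I => c I * ∏ i, (s : K) ^ I i, fun I => ?_, ?_, fun x => ?_⟩
  · beta_reduce
    rw [Finset.prod_pow_eq_pow_sum, norm_mul, norm_pow]
    rcases eq_zero_or_eq_single_or_two_le I with rfl | ⟨i, rfl⟩ | h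
    · simpa using h0
    · simpa using h1 i
    · calc ‖c I‖ * ‖(s : K)‖ ^ ∑ i, I i ≤ C * ‖(s : K)‖ ^ 2 :=
          mul_le_mul (hC I) (pow_le_pow_of_le_one (norm_nonneg _) hs h) (by positivity)
            ((norm_nonneg _).trans (hC I))
        _ ≤ ρ := h2
  · refine squeeze_zero_norm (fun I => ?_) (tendsto_zero_iff_norm_tendsto_zero.mp hc)
    rw [norm_mul]
    exact mul_le_of_le_one_right (norm_nonneg _) (norm_prod_pow_le_one _ (fun _ => hs) _)
  · convert! hF fun i => s * x i using 2 with I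
    simp only [MulMemClass.coe_mul, mul_pow, Finset.prod_mul_distrib, mul_assoc]

/-- A Tate series of Gauss norm at most `1` whose values have norm at most `‖s‖ ^ 2` has Gauss norm
at most `‖s‖ ^ 2` on the polydisk of radius `‖s‖`: the terms of degree at least `2` are small there,
and the constant and linear terms are controlled by the values at the origin and at the points
`s e i`, where `e i` are the unit vectors. -/
theorem IsTateLE.comp_smul_of_norm_le {F : (Fin n → ValRing K) → K} (hF : IsTateLE 1 F)
    (s : ValRing K) (h : ∀ x, ‖F x‖ ≤ ‖(s : K)‖ ^ 2) :
    IsTateLE (‖(s : K)‖ ^ 2) fun x => F (fun i => s * x i) := by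
  classical
  have hs := norm_coe_le_one s
  have hnn : 0 ≤ ‖(s : K)‖ ^ 2 := by positivity
  obtain ⟨c, h1, h2, h3⟩ := hF
  have h0 : ‖c 0‖ ≤ ‖(s : K)‖ ^ 2 := by
    have h4 : HasSum (fun I : Fin n →₀ ℕ => c I * ∏ i, (((0 : Fin n → ValRing K) i : K)) ^ I i)
        (c 0) := by
      have h5 := hasSum_single (f := fun I : Fin n →₀ ℕ =>
        c I * ∏ i, (((0 : Fin n → ValRing K) i : K)) ^ I i) 0 fun I hI => by
          obtain ⟨i, hi⟩ : ∃ i, I i ≠ 0 := by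
            by_contra! hcon
            exact hI (Finsupp.ext hcon)
          rw [Finset.prod_eq_zero (Finset.mem_univ i) (by simp [hi]), mul_zero]
      simpa using h5
    rw [h4.unique (h3 0)]
    exact h 0
  refine isTateLE_comp_smul h2 h3 s h0 (fun i => ?_) h1 (one_mul _).le
  let y : Fin n → ValRing K := Pi.single i s
  have hy : ∀ j, ‖(y j : K)‖ ≤ ‖(s : K)‖ := fun j => by
    by_cases hj : j = i
    · subst hj; simp [y]
    · simp [y, hj]
  have hsum := ((h3 y).sub (hasSum_ite_eq (0 : Fin n →₀ ℕ) (c 0))).sub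
    (hasSum_ite_eq (Finsupp.single i 1) (c (Finsupp.single i 1) * (s : K)))
  have hle := norm_le_of_hasSum hsum hnn fun I => ?_
  · rw [← norm_mul]
    have h5 : c (Finsupp.single i 1) * (s : K) = (F y + -c 0) +
      -(F y - c 0 - c (Finsupp.single i 1) * (s : K)) := by ring
    rw [h5]
    refine (IsUltrametricDist.norm_add_le_max _ _).trans (max_le ?_ ((norm_neg _).trans_le hle))
    exact (IsUltrametricDist.norm_add_le_max _ _).trans (max_le (h y) ((norm_neg _).trans_le h0))
  · rcases eq_zero_or_eq_single_or_two_le I with rfl | ⟨j, rfl⟩ | hI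
    · simp [(Finsupp.single_ne_zero.mpr one_ne_zero).symm, hnn]
    · by_cases hj : j = i
      · subst hj
        have : ∏ l, (y l : K) ^ (Finsupp.single j 1 : Fin n →₀ ℕ) l = s := by
          rw [Finset.prod_eq_single j]
          · simp [y]
          · intro l _ hl
            simp [hl]
          · simp
        simp [this, hnn]
      · have : ∏ l, (y l : K) ^ (Finsupp.single j 1 : Fin n →₀ ℕ) l = 0 :=
          Finset.prod_eq_zero (Finset.mem_univ j) (by simp [y, hj])
        rw [this]
        simp [Finsupp.single_left_inj, hj, hnn]
    · have hI0 : I ≠ 0 := by rintro rfl; simp at hI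
      have hI1 : I ≠ Finsupp.single i 1 := by
        rintro rfl
        simp at hI
      rw [if_neg hI0, if_neg hI1, sub_zero, sub_zero, norm_mul, norm_prod]
      calc ‖c I‖ * ∏ l, ‖(y l : K) ^ I l‖ ≤ 1 * ∏ l, ‖(s : K)‖ ^ I l := by
            refine mul_le_mul (h1 I) (Finset.prod_le_prod (fun _ _ => norm_nonneg _) fun l _ => ?_)
              (Finset.prod_nonneg fun _ _ => norm_nonneg _) zero_le_one
            rw [norm_pow]
            exact pow_le_pow_left₀ (norm_nonneg _) (hy l) _
        _ ≤ ‖(s : K)‖ ^ 2 := by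
            rw [one_mul, Finset.prod_pow_eq_pow_sum]
            exact pow_le_pow_of_le_one (norm_nonneg _) hs hI

omit [IsUltrametricDist K] in
theorem exists_norm_coeff_le {ι : Type*} [Finite ι] (q : ι → MvPolynomial (Fin n) K) :
    ∃ C : ℝ, 0 < C ∧ ∀ i I, ‖MvPolynomial.coeff I (q i)‖ ≤ C := by
  have := Fintype.ofFinite ι
  refine ⟨1 + ∑ i, ∑ I ∈ (q i).support, ‖MvPolynomial.coeff I (q i)‖, by positivity, fun i I => ?_⟩
  by_cases hI : I ∈ (q i).support
  · calc ‖MvPolynomial.coeff I (q i)‖ ≤ ∑ I ∈ (q i).support, ‖MvPolynomial.coeff I (q i)‖ :=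
        Finset.single_le_sum (f := fun I => ‖MvPolynomial.coeff I (q i)‖)
          (fun _ _ => norm_nonneg _) hI
      _ ≤ ∑ i, ∑ I ∈ (q i).support, ‖MvPolynomial.coeff I (q i)‖ :=
        Finset.single_le_sum (f := fun i => ∑ I ∈ (q i).support, ‖MvPolynomial.coeff I (q i)‖)
          (fun _ _ => by positivity) (Finset.mem_univ i)
      _ ≤ _ := by linarith
  · rw [MvPolynomial.notMem_support_iff.mp hI, norm_zero]
    positivity

omit [IsUltrametricDist K] in
theorem tendsto_coeff_cofinite (q : MvPolynomial (Fin n) K) :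
    Tendsto (fun I => MvPolynomial.coeff I q) cofinite (𝓝 0) := by
  refine tendsto_nhds_of_eventually_eq (q.support.finite_toSet.subset fun I hI => ?_)
  exact MvPolynomial.mem_support_iff.mpr hI

omit [IsUltrametricDist K] in
theorem hasSum_eval (q : MvPolynomial (Fin n) K) (y : Fin n → K) :
    HasSum (fun I : Fin n →₀ ℕ => MvPolynomial.coeff I q * ∏ i, y i ^ I i)
      (MvPolynomial.eval y q) := by
  rw [MvPolynomial.eval_eq']
  refine hasSum_sum_of_ne_finset_zero fun I hI => ?_
  rw [MvPolynomial.notMem_support_iff.mp hI, zero_mul]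

/-- The part of degree at least `2` of a polynomial without constant term. -/
noncomputable def higherPart (f : MvPolynomial (Fin N) K) : MvPolynomial (Fin N) K :=
  f - ∑ l, MvPolynomial.C (diffZero f l) * MvPolynomial.X l

omit [IsUltrametricDist K] in
theorem eval_eq_add_higherPart (f : MvPolynomial (Fin N) K) (y : Fin N → K) :
    MvPolynomial.eval y f = ∑ l, diffZero f l * y l + MvPolynomial.eval y (higherPart f) := by
  simp [higherPart]

theorem isTateLE_eval_higherPart {f : MvPolynomial (Fin N) K}
    (hf : MvPolynomial.constantCoeff f = 0) {C : ℝ}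
    (hC : ∀ I, ‖MvPolynomial.coeff I (higherPart f)‖ ≤ C) (s : ValRing K) :
    IsTateLE (C * ‖(s : K)‖ ^ 2) fun Y : Fin N → ValRing K =>
      MvPolynomial.eval (fun l => (s * Y l : K)) (higherPart f) := by
  have hC0 : 0 ≤ C := (norm_nonneg _).trans (hC 0)
  have hzero : MvPolynomial.coeff 0 (higherPart f) = 0 := by
    rw [← MvPolynomial.constantCoeff_eq]
    simp [higherPart, hf]
  have hlin : ∀ i, MvPolynomial.coeff (Finsupp.single i 1) (higherPart f) = 0 := by
    classical
    intro i
    rw [higherPart, MvPolynomial.coeff_sub, MvPolynomial.coeff_sum]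
    simp [MvPolynomial.coeff_C_mul, MvPolynomial.coeff_X, Finsupp.single_left_inj,
      diffZero_eq_coeff]
  have hnn : 0 ≤ C * ‖(s : K)‖ ^ 2 := by positivity
  have hsum : ∀ Y : Fin N → ValRing K,
      HasSum (fun I : Fin N →₀ ℕ => MvPolynomial.coeff I (higherPart f) * ∏ i, (Y i : K) ^ I i)
        (MvPolynomial.eval (fun l => (Y l : K)) (higherPart f)) := fun Y => hasSum_eval _ _
  exact isTateLE_comp_smul (c := fun I => MvPolynomial.coeff I (higherPart f))
    (tendsto_coeff_cofinite (higherPart f)) hsum s (by rw [hzero, norm_zero]; exact hnn)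
    (fun i => by rw [hlin, norm_zero, zero_mul]; exact hnn) hC le_rfl

theorem norm_eval_sub_constantCoeff_le {g : MvPolynomial (Fin N) K} {C : ℝ}
    (hC : ∀ I, ‖MvPolynomial.coeff I g‖ ≤ C) {y : Fin N → K} {ρ : ℝ} (hρ : ρ ≤ 1)
    (hρ0 : 0 ≤ ρ) (hy : ∀ l, ‖y l‖ ≤ ρ) :
    ‖MvPolynomial.eval y g - MvPolynomial.constantCoeff g‖ ≤ C * ρ := by
  classical
  have hC0 : 0 ≤ C := (norm_nonneg _).trans (hC 0)
  have h := (hasSum_eval g y).sub (hasSum_ite_eq (0 : Fin N →₀ ℕ) (MvPolynomial.constantCoeff g))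
  refine norm_le_of_hasSum h (by positivity) fun I => ?_
  by_cases hI : I = 0
  · subst hI
    simp [MvPolynomial.constantCoeff_eq]
    positivity
  rw [if_neg hI, sub_zero, norm_mul]
  refine mul_le_mul (hC I) ?_ (norm_nonneg _) hC0
  obtain ⟨i, hi⟩ : ∃ i, I i ≠ 0 := by
    by_contra! hcon
    exact hI (Finsupp.ext hcon)
  have hy1 : ∀ l, ‖y l‖ ≤ 1 := fun l => (hy l).trans hρ
  rw [← Finset.mul_prod_erase _ _ (Finset.mem_univ i), norm_mul, norm_pow]
  refine (mul_le_of_le_one_right (by positivity) (norm_prod_pow_le_one _ hy1 _)).trans ?_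
  exact (pow_le_of_le_one (norm_nonneg _) (hy1 i) hi).trans (hy i)

variable [CompleteSpace K] [CharZero K] {p : ℕ}

/-- Inverse function theorem for a Tate map congruent to the identity modulo `p ^ 2`; the inverse is
the time `-1` map of the flow. -/
theorem exists_inverse (hp : p.Prime) (hp1 : ‖(p : K)‖ < 1)
    {F : (Fin n → ValRing K) → Fin n → ValRing K}
    (hF : ∀ i, IsTateLE (‖(p : K)‖ ^ 2) fun x => (F x i : K) - x i) :
    ∃ G : (Fin n → ValRing K) → Fin n → ValRing K, (∀ i, IsTateLE 1 fun x => (G x i : K)) ∧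
      (∀ x, F (G x) = x) ∧ ∀ x, G (F x) = x := by
  obtain ⟨Φ, hΦ, hadd, hN⟩ := exists_flow hp hp1 hF
  have h1 : ∀ x, Φ 1 x = F x := fun x => by simpa using hN 1 x
  have h0 : ∀ x, Φ 0 x = x := fun x => by simpa using hN 0 x
  refine ⟨Φ (-1), fun i => ?_, fun x => ?_, fun x => ?_⟩
  · have h := (hΦ i).comp (G := fun z : Fin n → ValRing K => Fin.cons (-1) z) fun j => by
      refine Fin.cases ?_ (fun j => ?_) j
      · simpa using (isTateLE_const (n := n) (-1 : K))
      · simpa using isTateLE_coord j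
    simpa using h
  · rw [← h1, ← hadd, add_neg_cancel, h0]
  · rw [← h1, ← hadd, neg_add_cancel, h0]

omit [IsUltrametricDist K] [CompleteSpace K] [CharZero K] in
theorem exists_pow_mul_le (hp1 : ‖(p : K)‖ < 1) (C : ℝ) {δ : ℝ} (hδ : 0 < δ) :
    ∃ e : ℕ, C * ‖(p : K)‖ ^ e ≤ δ := by
  have h : Tendsto (fun e : ℕ => C * ‖(p : K)‖ ^ e) atTop (𝓝 0) := by
    simpa using (tendsto_pow_atTop_nhds_zero_of_lt_one (norm_nonneg _) hp1).const_mul C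
  exact (h.eventually (ge_mem_nhds hδ)).exists

/-- The zeros near the origin of a system `f` of polynomials with linearly independent differentials
are parametrized by a polydisk in their tangent space. The straightening map
`H(Y) = Y + ∑ i, s⁻¹ r i (s Y) v i`, where `r i` is the part of `f i` of degree at least `2` and
`s = p ^ e`, is congruent to the identity and maps the zeros into the tangent space. -/
theorem exists_local_parametrization (hp : p.Prime) (hp1 : ‖(p : K)‖ < 1) {c : ℕ}
    {f : Fin c → MvPolynomial (Fin N) K} {g : MvPolynomial (Fin N) K} {v : Fin c → Fin N → K}
    {τ : Fin m → Fin N → K} {b : Fin m → (Fin N → K) →ₗ[K] K}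
    (hf0 : ∀ i, MvPolynomial.constantCoeff (f i) = 0) (hg : MvPolynomial.constantCoeff g = 1)
    (hfv : ∀ i j, ∑ l, diffZero (f i) l * v j l = if i = j then 1 else 0)
    (hfτ : ∀ i j, ∑ l, diffZero (f i) l * τ j l = 0)
    (hbτ : ∀ i j, b i (τ j) = if i = j then 1 else 0) (hbv : ∀ i j, b i (v j) = 0)
    (hb : ∀ w : Fin N → K, (∀ i, ∑ l, diffZero (f i) l * w l = 0) → w = ∑ j, b j w • τ j)
    (hτ : ∀ j l, ‖τ j l‖ ≤ 1) :
    ∃ (e : ℕ) (θ : (Fin m → ValRing K) → Fin N → ValRing K),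
      (∀ l, IsTateLE 1 fun t => (θ t l : K)) ∧
      (∀ t i, MvPolynomial.eval (fun l => ((p : K) ^ e * θ t l : K)) (f i) = 0) ∧
      (∀ t j, b j (fun l => (θ t l : K)) = t j) ∧
      (∀ Y : Fin N → ValRing K,
        (∀ i, MvPolynomial.eval (fun l => ((p : K) ^ e * Y l : K)) (f i) = 0) →
        ∀ t : Fin m → ValRing K, (∀ j, b j (fun l => (Y l : K)) = t j) → Y = θ t) ∧
      ∀ Y : Fin N → ValRing K, MvPolynomial.eval (fun l => ((p : K) ^ e * Y l : K)) g ≠ 0 := by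
  have hpK : (p : K) ≠ 0 := Nat.cast_ne_zero.mpr hp.ne_zero
  have hppos : 0 < ‖(p : K)‖ := norm_pos_iff.mpr hpK
  obtain ⟨C, hC0, hC⟩ := exists_norm_coeff_le fun i => higherPart (f i)
  obtain ⟨D, hD0, hD⟩ := exists_norm_coeff_le fun _ : Unit => g
  obtain ⟨B, hB0, hB⟩ := exists_forall_norm_le v
  -- `B * C` bounds the deviation of the straightening map from the identity, and `D` bounds
  -- the deviation of `g` from `1`, up to powers of `p`
  obtain ⟨e, he⟩ := exists_pow_mul_le hp1 (B * C + D) (δ := ‖(p : K)‖ ^ 2) (by positivity)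
  have hp2 : ‖(p : K)‖ ^ 2 < 1 := pow_lt_one₀ (norm_nonneg _) hp1 two_ne_zero
  have hBC : B * C * ‖(p : K)‖ ^ e ≤ ‖(p : K)‖ ^ 2 := by
    refine le_trans ?_ he
    gcongr
    linarith
  have hDe : D * ‖(p : K)‖ ^ e < 1 := by
    refine lt_of_le_of_lt (le_trans ?_ he) hp2
    gcongr
    have := mul_nonneg hB0 hC0.le
    linarith
  let s : ValRing K := (p : ValRing K) ^ e
  have hs : (s : K) = (p : K) ^ e := by simp [s]
  have hs0 : (s : K) ≠ 0 := by rw [hs]; exact pow_ne_zero e hpK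
  have hsn : ‖(s : K)‖ = ‖(p : K)‖ ^ e := by rw [hs, norm_pow]
  let r : Fin c → (Fin N → ValRing K) → K := fun i Y =>
    (s : K)⁻¹ * MvPolynomial.eval (fun l => (s * Y l : K)) (higherPart (f i))
  have hr : ∀ i l, IsTateLE (‖(p : K)‖ ^ 2) fun Y => v i l * r i Y := by
    intro i l
    have h1 := (isTateLE_eval_higherPart (hf0 i) (hC i) s).const_mul (v i l * (s : K)⁻¹)
    have h2 : ‖v i l * (s : K)⁻¹‖ * (C * ‖(s : K)‖ ^ 2) ≤ ‖(p : K)‖ ^ 2 := by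
      have : ‖(s : K)‖ ≠ 0 := norm_ne_zero_iff.mpr hs0
      calc ‖v i l * (s : K)⁻¹‖ * (C * ‖(s : K)‖ ^ 2) = ‖v i l‖ * C * ‖(s : K)‖ := by
            rw [norm_mul, norm_inv]; field_simp
        _ ≤ B * C * ‖(p : K)‖ ^ e := by rw [hsn]; gcongr; exact hB i l
        _ ≤ _ := hBC
    simpa [r, mul_assoc] using h1.mono h2
  have hG : ∀ l, IsTateLE (‖(p : K)‖ ^ 2) fun Y => ∑ i, v i l * r i Y := fun l =>
    IsTateLE.sum _ (by positivity) fun i _ => hr i l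
  let H : (Fin N → ValRing K) → Fin N → ValRing K := fun Y l =>
    ⟨Y l + ∑ i, v i l * r i Y, mem_valRing_iff.mpr
      (((isTateLE_coord l).add ((hG l).mono hp2.le)).norm_le Y)⟩
  have hH : ∀ Y l, (H Y l : K) = Y l + ∑ i, v i l * r i Y := fun _ _ => rfl
  obtain ⟨G, hG1, hHG, hGH⟩ := exists_inverse hp hp1 (F := H) fun l => by
    simpa [hH] using hG l
  -- the differential of `f i` reads `f i` off the straightened point, and `b` does not notice the
  -- straightening
  have hHf : ∀ Y i, ∑ l, diffZero (f i) l * (H Y l : K) =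
      (s : K)⁻¹ * MvPolynomial.eval (fun l => (s * Y l : K)) (f i) := by
    intro Y i
    have h1 : ∑ l, diffZero (f i) l * ∑ j, v j l * r j Y = r i Y := by
      simp only [Finset.mul_sum]
      rw [Finset.sum_comm]
      simp only [← mul_assoc, ← Finset.sum_mul, hfv]
      simp
    simp only [hH, mul_add, Finset.sum_add_distrib, h1]
    rw [eval_eq_add_higherPart, mul_add, Finset.mul_sum]
    congr 1
    refine Finset.sum_congr rfl fun l _ => ?_
    field_simp
  have hHb : ∀ Y j, b j (fun l => (H Y l : K)) = b j fun l => (Y l : K) := by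
    intro Y j
    have h1 : (fun l => (H Y l : K)) = (fun l => (Y l : K)) + ∑ i, r i Y • v i := by
      funext l
      simp [hH, mul_comm]
    rw [h1, map_add, map_sum]
    simp [hbv]
  let T : (Fin m → ValRing K) → Fin N → ValRing K := fun t l =>
    ∑ j, t j * ⟨τ j l, mem_valRing_iff.mpr (hτ j l)⟩
  have hT : ∀ t l, (T t l : K) = ∑ j, (t j : K) * τ j l := fun t l => by simp [T]
  have hT' : ∀ t, (fun l => (T t l : K)) = ∑ j, (t j : K) • τ j := fun t => by
    funext l; simp [hT]
  refine ⟨e, fun t => G (T t), fun l => (hG1 l).comp fun l' => ?_, fun t i => ?_, fun t j => ?_,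
    fun Y hY t ht => ?_, fun Y hY => ?_⟩
  · simp only [hT]
    refine IsTateLE.sum _ zero_le_one fun j _ => ?_
    exact (isTateLE_coord j).mul_of_one ((isTateLE_const _).mono (hτ j l'))
  · have h1 := hHf (G (T t)) i
    rw [hHG] at h1
    have h2 : ∑ l, diffZero (f i) l * (T t l : K) = 0 := by
      simp only [hT, Finset.mul_sum]
      rw [Finset.sum_comm]
      refine Finset.sum_eq_zero fun j _ => ?_
      simp only [mul_left_comm _ (t j : K), ← Finset.mul_sum, hfτ, mul_zero]
    rw [h2] at h1
    rw [← hs]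
    exact (mul_eq_zero.mp h1.symm).resolve_left (inv_ne_zero hs0)
  · rw [← hHb, hHG, hT', map_sum]
    simp [hbτ]
  · have h1 : ∀ i, ∑ l, diffZero (f i) l * (H Y l : K) = 0 := fun i => by
      rw [hHf, hs, hY, mul_zero]
    have h2 := hb _ h1
    simp only [hHb, ht, ← hT'] at h2
    rw [← hGH Y]
    congr 1
    funext l
    exact Subtype.ext (congrFun h2 l)
  · have h1 := norm_eval_sub_constantCoeff_le (hD ()) (y := fun l => ((p : K) ^ e * Y l : K))
      (ρ := ‖(p : K)‖ ^ e) (pow_le_one₀ (norm_nonneg _) hp1.le) (by positivity) fun l => by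
        rw [norm_mul, norm_pow]
        exact mul_le_of_le_one_right (by positivity) (norm_coe_le_one _)
    rw [hY, hg, zero_sub, norm_neg, norm_one] at h1
    exact absurd (h1.trans_lt hDe) (lt_irrefl _)

end

/-! ### Integral points and integral charts -/

section

section PointsAlgebra

variable {R A : Type u} [CommRing R] [CommRing A] [Algebra R A] {N : ℕ}

theorem Points.ext {x y : Points R A} (h : ∀ a, x.eval a = y.eval a) : x = y :=
  AlgHom.ext (A := A) (B := R) h

theorem Points.ext_of_surjective {a : Fin N → A}
    (ha : Function.Surjective (MvPolynomial.aeval a : MvPolynomial (Fin N) R →ₐ[R] A))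
    {x y : Points R A} (h : ∀ l, x.eval (a l) = y.eval (a l)) : x = y := by
  refine Points.ext fun b => ?_
  obtain ⟨q, rfl⟩ := ha b
  have h1 : x.toAlgHom.comp (MvPolynomial.aeval a) = y.toAlgHom.comp (MvPolynomial.aeval a) :=
    MvPolynomial.algHom_ext fun l => by simpa [Points.eval] using h l
  exact DFunLike.congr_fun h1 q

/-- Finitely many generators of the coordinate ring can be chosen to vanish at a given point. -/
theorem exists_generators_vanishing [Algebra.FiniteType R A] (x : Points R A) :
    ∃ (N : ℕ) (a : Fin N → A),
      Function.Surjective (MvPolynomial.aeval a : MvPolynomial (Fin N) R →ₐ[R] A) ∧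
      ∀ l, x.eval (a l) = 0 := by
  obtain ⟨N, f, hf⟩ := Algebra.FiniteType.iff_quotient_mvPolynomial''.mp
    (inferInstance : Algebra.FiniteType R A)
  let c : Fin N → R := fun l => x.eval (f (MvPolynomial.X l))
  let a : Fin N → A := fun l => f (MvPolynomial.X l) - algebraMap R A (c l)
  refine ⟨N, a, fun b => ?_, fun l => ?_⟩
  · obtain ⟨q, rfl⟩ := hf b
    refine ⟨MvPolynomial.aeval (fun l => MvPolynomial.X l + MvPolynomial.C (c l)) q, ?_⟩
    have h1 : (MvPolynomial.aeval a).comp (MvPolynomial.aeval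
        (fun l => (MvPolynomial.X l + MvPolynomial.C (c l) : MvPolynomial (Fin N) R))) = f :=
      MvPolynomial.algHom_ext fun l => by
        simp [a]
    exact DFunLike.congr_fun h1 q
  · simp [a, c, Points.eval]

end PointsAlgebra

section GenericFibre

variable {R A : Type u} [CommRing R] [CommRing A] [Algebra R A] {K : Type u} [Field K] [Algebra R K]
  {N : ℕ}

theorem aeval_tmul_map (a : Fin N → A) (q : MvPolynomial (Fin N) R) :
    MvPolynomial.aeval (fun l => (1 : K) ⊗ₜ[R] a l) (MvPolynomial.map (algebraMap R K) q) =
      (1 : K) ⊗ₜ[R] MvPolynomial.aeval a q := by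
  rw [MvPolynomial.aeval_map_algebraMap]
  have h1 : (Algebra.TensorProduct.includeRight : A →ₐ[R] K ⊗[R] A).comp (MvPolynomial.aeval a) =
      MvPolynomial.aeval (fun l => (1 : K) ⊗ₜ[R] a l) :=
    MvPolynomial.algHom_ext fun l => by simp
  exact (DFunLike.congr_fun h1 q).symm

theorem aeval_tmul_surjective {a : Fin N → A}
    (ha : Function.Surjective (MvPolynomial.aeval a : MvPolynomial (Fin N) R →ₐ[R] A)) :
    Function.Surjective (MvPolynomial.aeval (fun l => (1 : K) ⊗ₜ[R] a l) :
      MvPolynomial (Fin N) K →ₐ[K] K ⊗[R] A) := by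
  intro z
  induction z using TensorProduct.induction_on with
  | zero => exact ⟨0, map_zero _⟩
  | tmul c b =>
    obtain ⟨q, rfl⟩ := ha b
    refine ⟨MvPolynomial.C c * MvPolynomial.map (algebraMap R K) q, ?_⟩
    rw [map_mul, aeval_tmul_map]
    simp [Algebra.TensorProduct.algebraMap_apply]
  | add z w hz hw =>
    obtain ⟨f, rfl⟩ := hz
    obtain ⟨g, rfl⟩ := hw
    exact ⟨f + g, map_add _ _ _⟩

/-- The `K`-point of the generic fibre defined by an `R`-point. -/
noncomputable def Points.generic (K : Type u) [Field K] [Algebra R K] (y : Points R A) :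
    K ⊗[R] A →ₐ[K] K :=
  Algebra.TensorProduct.lift (AlgHom.id K K) ((Algebra.ofId R K).comp y.toAlgHom)
    fun _ _ => Commute.all _ _

theorem Points.generic_tmul (y : Points R A) (a : A) :
    y.generic K ((1 : K) ⊗ₜ[R] a) = algebraMap R K (y.eval a) := by
  simp [Points.generic, Points.eval, Algebra.ofId_apply]

theorem Points.eval_eq_zero_of_aeval_eq_zero (y : Points R A) {a : Fin N → A}
    {h : MvPolynomial (Fin N) K} (hh : MvPolynomial.aeval (fun l => (1 : K) ⊗ₜ[R] a l) h = 0) :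
    MvPolynomial.eval (fun l => algebraMap R K (y.eval (a l))) h = 0 := by
  have h1 := congrArg (y.generic K) hh
  rw [← AlgHom.comp_apply, MvPolynomial.comp_aeval, map_zero] at h1
  simpa [Points.generic_tmul, MvPolynomial.aeval_eq_eval] using h1

/-- A zero with coordinates in `R` of the equations of the generic fibre is an `R`-point. -/
theorem exists_point_of_eval_eq_zero (hinj : Function.Injective (algebraMap R K)) {a : Fin N → A}
    (ha : Function.Surjective (MvPolynomial.aeval a : MvPolynomial (Fin N) R →ₐ[R] A))
    {Z : Fin N → R} (hZ : ∀ h : MvPolynomial (Fin N) K,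
      MvPolynomial.aeval (fun l => (1 : K) ⊗ₜ[R] a l) h = 0 →
        MvPolynomial.eval (fun l => algebraMap R K (Z l)) h = 0) :
    ∃ y : Points R A, ∀ l, y.eval (a l) = Z l := by
  have hker : RingHom.ker (MvPolynomial.aeval a : MvPolynomial (Fin N) R →ₐ[R] A) ≤
      RingHom.ker (MvPolynomial.aeval Z : MvPolynomial (Fin N) R →ₐ[R] R) := by
    intro q hq
    have h1 := hZ (MvPolynomial.map (algebraMap R K) q) (by
      rw [aeval_tmul_map, RingHom.mem_ker.mp hq, TensorProduct.tmul_zero])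
    rw [MvPolynomial.eval_map, ← MvPolynomial.aeval_def, ← Function.comp_def (algebraMap R K) Z,
      MvPolynomial.aeval_algebraMap_apply] at h1
    exact hinj (by rw [h1, map_zero])
  let y : A →ₐ[R] R := AlgHom.liftOfSurjective _ ha _ hker
  refine ⟨y, fun l => ?_⟩
  have h2 : y (MvPolynomial.aeval a (MvPolynomial.X l)) = MvPolynomial.aeval Z (MvPolynomial.X l) :=
    AlgHom.liftOfSurjective_apply ..
  rwa [MvPolynomial.aeval_X, MvPolynomial.aeval_X] at h2

end GenericFibre

variable {K : Type u} [NontriviallyNormedField K] [IsUltrametricDist K] [CompleteSpace K]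
  [CharZero K] {p m : ℕ} {A : Type u} [CommRing A] [Algebra (ValRing K) A]

omit [CharZero K] in
theorem isTateLE_eval {N : ℕ} {a : Fin N → A}
    (ha : Function.Surjective
      (MvPolynomial.aeval a : MvPolynomial (Fin N) (ValRing K) →ₐ[ValRing K] A))
    {ψ : (Fin m → ValRing K) → Points (ValRing K) A}
    (hψ : ∀ l, IsTateLE 1 fun t => ((ψ t).eval (a l) : K)) (b : A) :
    IsTateLE 1 fun t => ((ψ t).eval b : K) := by
  obtain ⟨q, rfl⟩ := ha b
  induction q using MvPolynomial.induction_on with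
  | C c =>
    have h1 : ∀ t, (ψ t).eval (MvPolynomial.aeval a (MvPolynomial.C c)) = c := fun t => by
      simp [Points.eval]
    simp only [h1]
    exact (isTateLE_const (c : K)).mono (norm_coe_le_one c)
  | add f g hf hg => simpa [Points.eval] using hf.add hg
  | mul_X f l hf => simpa [Points.eval] using hf.mul_of_one (hψ l)

/-- Integral charts. Near an `𝔬`-point `x`, the set `V(𝔬)` is parametrized by a polydisk; the
inverse of the parametrization is linear in suitable coordinates `a` that vanish at `x`. -/
theorem exists_parametrization [Algebra.FiniteType (ValRing K) A] (hp : p.Prime)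
    (hp1 : ‖(p : K)‖ < 1)
    (hV : AlgebraicGeometry.SmoothOfRelativeDimension m (AlgebraicGeometry.Spec.map
      (CommRingCat.ofHom (algebraMap K (K ⊗[ValRing K] A)))))
    (x : Points (ValRing K) A) :
    ∃ (N : ℕ) (a : Fin N → A) (e : ℕ) (b : Fin m → (Fin N → K) →ₗ[K] K)
      (ψ : (Fin m → ValRing K) → Points (ValRing K) A),
      (∀ l, x.eval (a l) = 0) ∧
      (∀ c : A, IsTateLE 1 fun t => ((ψ t).eval c : K)) ∧
      (∀ t l, ‖((ψ t).eval (a l) : K)‖ ≤ ‖(p : K)‖ ^ e) ∧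
      (∀ t j, b j (fun l => ((ψ t).eval (a l) : K)) = (p : K) ^ e * t j) ∧
      ∀ y : Points (ValRing K) A, (∀ l, ‖(y.eval (a l) : K)‖ ≤ ‖(p : K)‖ ^ e) →
        ∀ t : Fin m → ValRing K,
          (∀ j, b j (fun l => (y.eval (a l) : K)) = (p : K) ^ e * t j) → y = ψ t := by
  have hpK : (p : K) ≠ 0 := Nat.cast_ne_zero.mpr hp.ne_zero
  obtain ⟨N, a, ha, hxa⟩ := exists_generators_vanishing x
  obtain ⟨c, f, g, v, τ, b, hfI, hg, hgI, hfv, hfτ, hbτ, hbv, hb⟩ :=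
    exists_local_equations (a := fun l => (1 : K) ⊗ₜ[ValRing K] a l) hV (x.generic K)
      (fun l => by rw [Points.generic_tmul, hxa, map_zero]) (aeval_tmul_surjective ha)
  -- rescale the basis of the tangent space so that it becomes integral
  obtain ⟨B, -, hB⟩ := exists_forall_norm_le τ
  obtain ⟨d, hd⟩ := exists_pow_mul_le hp1 B one_pos
  have hpd : (p : K) ^ d ≠ 0 := pow_ne_zero d hpK
  have hτ : ∀ j l, ‖((p : K) ^ d • τ j) l‖ ≤ 1 := fun j l => by
    rw [Pi.smul_apply, norm_smul, norm_pow, mul_comm]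
    refine le_trans ?_ hd
    gcongr
    exact hB j l
  have hf0 : ∀ i, MvPolynomial.constantCoeff (f i) = 0 := fun i => by
    have := x.eval_eq_zero_of_aeval_eq_zero (hfI i)
    simpa [hxa, MvPolynomial.eval_zero'] using this
  obtain ⟨e, θ, hθ, hθf, hθb, hθu, hge⟩ := exists_local_parametrization hp hp1 (g := g) (v := v)
    (τ := fun j => (p : K) ^ d • τ j) (b := fun j => ((p : K) ^ d)⁻¹ • b j) hf0 hg hfv
    (fun i j => by
      simp only [Pi.smul_apply, smul_eq_mul, mul_left_comm _ ((p : K) ^ d), ← Finset.mul_sum, hfτ,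
        mul_zero])
    (fun i j => by simp [hbτ, hpd])
    (fun i j => by simp [hbv])
    (fun w hw => by
      refine (hb w hw).trans (Finset.sum_congr rfl fun j _ => ?_)
      rw [LinearMap.smul_apply, smul_smul, smul_eq_mul, mul_right_comm, inv_mul_cancel₀ hpd,
        one_mul])
    hτ
  -- the zeros of `f` are zeros of the whole ideal, because `g` does not vanish nearby
  have hpt : ∀ t, ∃ y : Points (ValRing K) A,
      ∀ l, y.eval (a l) = (p : ValRing K) ^ e * θ t l := fun t => by
    refine exists_point_of_eval_eq_zero (K := K) Subtype.val_injective ha fun h hh => ?_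
    have hco : (fun l => algebraMap (ValRing K) K ((p : ValRing K) ^ e * θ t l)) =
        fun l => (p : K) ^ e * θ t l := by
      funext l
      simp
    rw [hco]
    have h1 : Ideal.span (Set.range f) ≤
        RingHom.ker (MvPolynomial.eval fun l => ((p : K) ^ e * θ t l : K)) := by
      refine Ideal.span_le.mpr ?_
      rintro _ ⟨i, rfl⟩
      exact hθf t i
    have h2 : MvPolynomial.eval (fun l => ((p : K) ^ e * θ t l : K)) (g * h) = 0 := h1 (hgI h hh)
    rw [map_mul] at h2
    exact (mul_eq_zero.mp h2).resolve_left (hge (θ t))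
  choose ψ hψ using hpt
  have hψ' : ∀ t l, ((ψ t).eval (a l) : K) = (p : K) ^ e * θ t l := fun t l => by
    rw [hψ]; simp
  have hpe : ‖(p : K) ^ e‖ ≤ 1 := by
    rw [norm_pow]
    exact pow_le_one₀ (norm_nonneg _) hp1.le
  refine ⟨N, a, e, fun j => ((p : K) ^ d)⁻¹ • b j, ψ, hxa,
    isTateLE_eval ha fun l => ?_, fun t l => ?_, fun t j => ?_, fun y hy t ht => ?_⟩
  · simp only [hψ']
    exact ((hθ l).const_mul _).mono (by simpa using hpe)
  · rw [hψ', norm_mul, norm_pow]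
    exact mul_le_of_le_one_right (by positivity) (norm_coe_le_one _)
  · have h1 : (fun l => ((ψ t).eval (a l) : K)) = (p : K) ^ e • fun l => (θ t l : K) := by
      funext l
      simp [hψ']
    rw [h1, map_smul, hθb, smul_eq_mul]
  · have hpe0 : (p : K) ^ e ≠ 0 := pow_ne_zero e hpK
    let Y : Fin N → ValRing K := fun l => ⟨((p : K) ^ e)⁻¹ * y.eval (a l), mem_valRing_iff.mpr (by
      rw [norm_mul, norm_inv, norm_pow, inv_mul_le_iff₀ (pow_pos (norm_pos_iff.mpr hpK) e), mul_one]
      exact hy l)⟩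
    have hY : ∀ l, ((p : K) ^ e * Y l : K) = y.eval (a l) := fun l =>
      mul_inv_cancel_left₀ hpe0 _
    have hYt : Y = θ t := by
      refine hθu Y (fun i => ?_) t fun j => ?_
      · simp only [hY]
        exact y.eval_eq_zero_of_aeval_eq_zero (hfI i)
      · have h1 : (fun l => (Y l : K)) = ((p : K) ^ e)⁻¹ • fun l => (y.eval (a l) : K) := by
          funext l
          simp [Y]
        rw [h1, map_smul, ht, smul_eq_mul, inv_mul_cancel_left₀ hpe0]
    refine Points.ext_of_surjective ha fun l => Subtype.ext ?_
    rw [hψ', ← hYt, hY]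

end

/-! ### Flows on charts, compactness and congruence subgroups -/

section

variable {K : Type u} [NontriviallyNormedField K] [IsUltrametricDist K] {p m : ℕ}
  {A : Type u} [CommRing A] [Algebra (ValRing K) A]

/-- The flow on a chart `U` of an automorphism `f` that preserves `U` and is congruent to the
identity there. -/
theorem exists_unique_flow_on_chart [CompleteSpace K] [CharZero K] (hp : p.Prime)
    (hp1 : ‖(p : K)‖ < 1) {U : Set (Points (ValRing K) A)} (φ : (Fin m → ValRing K) ≃ U)
    (f : AutScheme (ValRing K) A) {F : (Fin m → ValRing K) → Fin m → ValRing K}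
    (hF : ∀ i, IsTateLE (‖(p : K)‖ ^ 2) fun x => (F x i : K) - x i)
    (hφF : ∀ t, (φ (F t)).1 = f • (φ t).1) :
    ∃ Φ : ValRing K → U → U, IsAnalyticFlow (ValRing K).toSubring φ Φ ∧
      (∀ (n : ℤ) (y : U), (Φ (n : ValRing K) y).1 = (f ^ n) • y.1) ∧
      ∀ Ψ : ValRing K → U → U, IsAnalyticFlow ⊤ φ Ψ →
        (∀ (n : ℤ) (y : U), (Ψ (n : ValRing K) y).1 = (f ^ n) • y.1) → Ψ = Φ := by
  obtain ⟨Φ', hΦ', hadd, hN⟩ := exists_flow hp hp1 hF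
  let Φ : ValRing K → U → U := fun t y => φ (Φ' t (φ.symm y))
  have hadd' : ∀ (s t : ValRing K) (y : U), Φ (s + t) y = Φ s (Φ t y) := fun s t y => by
    simp [Φ, hadd]
  have hnat : ∀ (n : ℕ) (y : U), (Φ (n : ValRing K) y).1 = (f ^ n) • y.1 := by
    intro n
    have : ∀ t, (φ (F^[n] t)).1 = (f ^ n) • (φ t).1 := by
      induction n with
      | zero => simp
      | succ n ih =>
        intro t
        rw [Function.iterate_succ_apply', hφF, ih, pow_succ', mul_smul]
    intro y
    simp [Φ, hN, this]
  have hint : ∀ (n : ℤ) (y : U), (Φ (n : ValRing K) y).1 = (f ^ n) • y.1 := by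
    intro n y
    obtain ⟨N, rfl | rfl⟩ := n.eq_nat_or_neg
    · simpa using hnat N y
    · have h1 := hnat N (Φ ((-(N : ℤ) : ℤ) : ValRing K) y)
      rw [← hadd', Int.cast_neg, Int.cast_natCast, add_neg_cancel] at h1
      have h2 := hnat 0 y
      rw [Nat.cast_zero, pow_zero, one_smul] at h2
      rw [h2] at h1
      rw [Int.cast_neg, Int.cast_natCast, zpow_neg, zpow_natCast, h1, inv_smul_smul]
  refine ⟨Φ, ⟨fun i => ?_, hadd'⟩, hint, fun Ψ hΨ hΨn => ?_⟩
  · simpa [Φ] using (hΦ' i).isTate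
  · have hcurve : ∀ {r : ℝ} {G : ValRing K → U → U} {i : Fin m}, (IsTateLE r
        fun z : Fin (m + 1) → ValRing K => (φ.symm (G (z 0) (φ (Fin.tail z))) i : K)) →
        ∀ y, IsTateLE r fun z : Fin 1 → ValRing K => (φ.symm (G (z 0) y) i : K) := by
      intro r G i hG y
      have h := hG.comp (G := fun z : Fin 1 → ValRing K => Fin.cons (z 0) (φ.symm y)) fun j => by
        refine Fin.cases ?_ (fun j => ?_) j
        · simpa using isTateLE_coord (K := K) (0 : Fin 1)
        · simpa using (isTateLE_const (n := 1) (φ.symm y j : K)).mono (norm_coe_le_one _)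
      simpa using h
    funext t y
    apply φ.symm.injective
    funext i
    obtain ⟨r, -, hr⟩ := (hΨ.analytic i).exists_isTateLE
    have hΦi : IsTateLE 1 fun z : Fin (m + 1) → ValRing K =>
        (φ.symm (Φ (z 0) (φ (Fin.tail z))) i : K) := by simpa [Φ] using hΦ' i
    refine Subtype.ext (IsTateLE.eq_of_forall_natCast hp hp1
      (f := fun t => (φ.symm (Ψ t y) i : K)) (g := fun t => (φ.symm (Φ t y) i : K))
      (hcurve hr y) (hcurve hΦi y) (fun n => ?_) t)
    have h1 : Ψ (n : ValRing K) y = Φ (n : ValRing K) y := by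
      apply Subtype.ext
      have h2 := hΨn n y
      have h3 := hint n y
      rw [Int.cast_natCast] at h2 h3
      rw [h2, h3]
    rw [h1]

theorem Points.continuous_eval {R A : Type u} [CommRing R] [CommRing A] [Algebra R A]
    [TopologicalSpace R] (a : A) : Continuous fun y : Points R A => y.eval a :=
  (continuous_apply a).comp
    (continuous_induced_dom (f := fun (x : Points R A) (a : A) => x.eval a))

instance [LocallyCompactSpace K] : CompactSpace (ValRing K) := by
  have : ProperSpace K := ProperSpace.of_locallyCompactSpace K
  have h : ((ValRing K : ValuationSubring K) : Set K) = Metric.closedBall 0 1 := by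
    ext x
    rw [SetLike.mem_coe, mem_valRing_iff, mem_closedBall_zero_iff]
  refine isCompact_iff_compactSpace.mp ?_
  rw [h]
  exact isCompact_closedBall 0 1

/-- `V(𝔬)` is closed in the product of copies of `𝔬` indexed by the coordinate ring. -/
instance [LocallyCompactSpace K] : CompactSpace (Points (ValRing K) A) := by
  let ι : Points (ValRing K) A → A → ValRing K := fun y a => y.eval a
  have hι : Topology.IsClosedEmbedding ι := by
    refine ⟨⟨⟨rfl⟩, fun x y h => Points.ext fun a => congrFun h a⟩, ?_⟩
    have hrange : Set.range ι = {g | (∀ a b, g (a + b) = g a + g b) ∧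
        (∀ a b, g (a * b) = g a * g b) ∧ ∀ r, g (algebraMap _ A r) = r} := by
      ext g
      constructor
      · rintro ⟨y, rfl⟩
        exact ⟨map_add y.toAlgHom, map_mul y.toAlgHom, y.toAlgHom.commutes⟩
      · rintro ⟨h1, h2, h3⟩
        let y : A →ₐ[ValRing K] ValRing K :=
          { toFun := g
            map_add' := h1
            map_mul' := h2
            map_zero' := by simpa using h3 0
            map_one' := by simpa using h3 1
            commutes' := h3 }
        exact ⟨y, rfl⟩
    rw [hrange]
    simp only [Set.ofPred_and, Set.ofPred_forall]
    refine IsClosed.inter ?_ (IsClosed.inter ?_ ?_)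
    · exact isClosed_iInter fun a => isClosed_iInter fun b => isClosed_eq (continuous_apply _)
        ((continuous_apply a).add (continuous_apply b))
    · exact isClosed_iInter fun a => isClosed_iInter fun b => isClosed_eq (continuous_apply _)
        ((continuous_apply a).mul (continuous_apply b))
    · exact isClosed_iInter fun r => isClosed_eq (continuous_apply _) continuous_const
  exact hι.compactSpace

/-- The automorphisms that move every regular function by at most `r` at every `𝔬`-point. For
`r = ‖p‖ ^ M` they are those that act trivially on `V(𝔬)` modulo `p ^ M`. -/
def congruenceSubgroup (K : Type u) [NontriviallyNormedField K] [IsUltrametricDist K]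
    (A : Type u) [CommRing A] [Algebra (ValRing K) A] (r : ℝ) (hr : 0 ≤ r) :
    Subgroup (AutScheme (ValRing K) A) where
  carrier := {f | ∀ (y : Points (ValRing K) A) (a : A), ‖((f • y).eval a - y.eval a : K)‖ ≤ r}
  one_mem' y a := by simpa using hr
  mul_mem' {f g} hf hg y a := by
    rw [mul_smul, ← sub_add_sub_cancel]
    exact (IsUltrametricDist.norm_add_le_max _ _).trans (max_le (hf _ _) (hg _ _))
  inv_mem' {f} hf y a := by
    have h := hf (f⁻¹ • y) a
    rwa [smul_inv_smul, norm_sub_rev] at h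

/-- Congruence up to `r` of `𝔬`-points. -/
def congruenceSetoid (K : Type u) [NontriviallyNormedField K] [IsUltrametricDist K]
    (A : Type u) [CommRing A] [Algebra (ValRing K) A] (r : ℝ) (hr : 0 ≤ r) :
    Setoid (Points (ValRing K) A) where
  r y z := ∀ a : A, ‖(y.eval a - z.eval a : K)‖ ≤ r
  iseqv :=
    { refl := fun y a => by simpa using hr
      symm := fun h a => by rw [norm_sub_rev]; exact h a
      trans := fun {x y z} h h' a => by
        rw [← sub_add_sub_cancel (x.eval a : K) (y.eval a)]
        exact (IsUltrametricDist.norm_add_le_max _ _).trans (max_le (h a) (h' a)) }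

theorem norm_eval_sub_eval_le {N : ℕ} {a : Fin N → A}
    (ha : Function.Surjective
      (MvPolynomial.aeval a : MvPolynomial (Fin N) (ValRing K) →ₐ[ValRing K] A))
    {y z : Points (ValRing K) A} {r : ℝ} (hr : 0 ≤ r)
    (h : ∀ l, ‖(y.eval (a l) - z.eval (a l) : K)‖ ≤ r) (b : A) :
    ‖(y.eval b - z.eval b : K)‖ ≤ r := by
  obtain ⟨q, rfl⟩ := ha b
  induction q using MvPolynomial.induction_on with
  | C c => simpa [Points.eval] using hr
  | add f g hf hg =>
    have : ((y.eval (MvPolynomial.aeval a (f + g)) - z.eval (MvPolynomial.aeval a (f + g)) : K)) =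
        (y.eval (MvPolynomial.aeval a f) - z.eval (MvPolynomial.aeval a f)) +
        (y.eval (MvPolynomial.aeval a g) - z.eval (MvPolynomial.aeval a g)) := by
      simp [Points.eval]; ring
    rw [this]
    exact (IsUltrametricDist.norm_add_le_max _ _).trans (max_le hf hg)
  | mul_X f l hf =>
    have : ((y.eval (MvPolynomial.aeval a (f * MvPolynomial.X l)) -
          z.eval (MvPolynomial.aeval a (f * MvPolynomial.X l)) : K)) =
        (y.eval (MvPolynomial.aeval a f) - z.eval (MvPolynomial.aeval a f)) * y.eval (a l) +
        z.eval (MvPolynomial.aeval a f) * (y.eval (a l) - z.eval (a l)) := by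
      simp [Points.eval]; ring
    rw [this]
    refine (IsUltrametricDist.norm_add_le_max _ _).trans (max_le ?_ ?_) <;> rw [norm_mul]
    · exact (mul_le_of_le_one_right (norm_nonneg _) (norm_coe_le_one _)).trans hf
    · exact (mul_le_of_le_one_left (norm_nonneg _) (norm_coe_le_one _)).trans (h l)

/-- The classes are open, as congruence may be tested on finitely many generators, and `V(𝔬)` is
compact. -/
theorem finite_quotient_congruenceSetoid [LocallyCompactSpace K]
    [Algebra.FiniteType (ValRing K) A] {r : ℝ} (hr : 0 < r) :
    Finite (Quotient (congruenceSetoid K A r hr.le)) := by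
  obtain ⟨N, a, ha⟩ : ∃ (N : ℕ) (a : Fin N → A), Function.Surjective
      (MvPolynomial.aeval a : MvPolynomial (Fin N) (ValRing K) →ₐ[ValRing K] A) := by
    obtain ⟨N, f, hf⟩ := Algebra.FiniteType.iff_quotient_mvPolynomial''.mp
      (inferInstance : Algebra.FiniteType (ValRing K) A)
    refine ⟨N, f ∘ MvPolynomial.X, ?_⟩
    rw [← MvPolynomial.aeval_unique f]
    exact hf
  have hloc : IsLocallyConstant (Quotient.mk (congruenceSetoid K A r hr.le)) := by
    rw [IsLocallyConstant.iff_eventually_eq]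
    intro y
    have h1 : ∀ l, ∀ᶠ z : Points (ValRing K) A in 𝓝 y,
        ‖(z.eval (a l) - y.eval (a l) : K)‖ ≤ r := by
      intro l
      have hc : Continuous fun z : Points (ValRing K) A => ‖(z.eval (a l) - y.eval (a l) : K)‖ :=
        ((continuous_subtype_val.comp (Points.continuous_eval (a l))).sub continuous_const).norm
      refine hc.continuousAt.eventually (ge_mem_nhds ?_)
      simpa using hr
    filter_upwards [eventually_all.mpr h1] with z hz
    exact Quotient.sound fun b => norm_eval_sub_eval_le ha hr.le hz b
  have h2 := hloc.range_finite
  rw [Set.range_eq_univ.mpr Quotient.mk_surjective] at h2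
  exact Set.finite_univ_iff.mp h2

/-- Congruence subgroups have finite index: an automorphism is determined, modulo the congruence
subgroup, by its action on the finite set of congruence classes of `𝔬`-points. -/
theorem finiteIndex_congruenceSubgroup [LocallyCompactSpace K]
    [Algebra.FiniteType (ValRing K) A] {r : ℝ} (hr : 0 < r) :
    (congruenceSubgroup K A r hr.le).FiniteIndex := by
  have hfin := finite_quotient_congruenceSetoid (K := K) (A := A) hr
  have hsm : ∀ (f : AutScheme (ValRing K) A) (y z : Points (ValRing K) A),
      (congruenceSetoid K A r hr.le) y z → (congruenceSetoid K A r hr.le) (f • y) (f • z) :=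
    fun f y z h a => h (f.unop a)
  let ρ : AutScheme (ValRing K) A → Quotient (congruenceSetoid K A r hr.le) →
      Quotient (congruenceSetoid K A r hr.le) := fun f q => Quotient.mk _ (f • q.out)
  have hρ : ∀ f g, ρ f = ρ g → f⁻¹ * g ∈ congruenceSubgroup K A r hr.le := by
    intro f g hfg y
    have h1 : (congruenceSetoid K A r hr.le)
        (f • (Quotient.mk (congruenceSetoid K A r hr.le) y).out)
        (g • (Quotient.mk (congruenceSetoid K A r hr.le) y).out) :=
      Quotient.exact (congrFun hfg (Quotient.mk _ y))
    have h2 := hsm f⁻¹ _ _ h1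
    rw [inv_smul_smul, smul_smul] at h2
    have h3 := Quotient.mk_out (s := congruenceSetoid K A r hr.le) y
    have h4 := hsm (f⁻¹ * g) _ _ h3
    exact (congruenceSetoid K A r hr.le).trans ((congruenceSetoid K A r hr.le).symm h4)
      ((congruenceSetoid K A r hr.le).trans ((congruenceSetoid K A r hr.le).symm h2) h3)
  have : Finite (AutScheme (ValRing K) A ⧸ congruenceSubgroup K A r hr.le) := by
    refine Finite.of_injective (fun q => ρ q.out) fun q q' h => ?_
    have h1 := QuotientGroup.eq.mpr (hρ _ _ h)
    rwa [QuotientGroup.out_eq', QuotientGroup.out_eq'] at h1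
  exact Subgroup.finiteIndex_of_finite_quotient

end

/-! ### Invariant charts and the theorem -/

section

variable {K : Type u} [NontriviallyNormedField K] [IsUltrametricDist K] {p m : ℕ}
  {A : Type u} [CommRing A] [Algebra (ValRing K) A]

theorem norm_linearMap_le {N : ℕ} {b : (Fin N → K) →ₗ[K] K} {B : ℝ}
    (hB : ∀ l, ‖b (fun j => if l = j then 1 else 0)‖ ≤ B) (hB0 : 0 ≤ B) {w : Fin N → K} {r : ℝ}
    (hr : 0 ≤ r) (hw : ∀ l, ‖w l‖ ≤ r) : ‖b w‖ ≤ B * r := by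
  rw [LinearMap.pi_apply_eq_sum_univ b w]
  refine IsUltrametricDist.norm_sum_le_of_forall_le_of_nonneg (by positivity) fun l _ => ?_
  rw [norm_smul, mul_comm]
  exact mul_le_mul (hB l) (hw l) (norm_nonneg _) hB0

theorem IsTateLE.linearMap_comp {n N : ℕ} {b : (Fin N → K) →ₗ[K] K} {B : ℝ}
    (hB : ∀ l, ‖b (fun j => if l = j then 1 else 0)‖ ≤ B) (hB0 : 0 ≤ B)
    {w : (Fin n → ValRing K) → Fin N → K} {r : ℝ} (hr : 0 ≤ r)
    (hw : ∀ l, IsTateLE r fun t => w t l) : IsTateLE (B * r) fun t => b (w t) := by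
  rw [funext fun t => LinearMap.pi_apply_eq_sum_univ b (w t)]
  refine IsTateLE.sum _ (by positivity) fun l _ => ?_
  have h := ((hw l).const_mul (b fun j => if l = j then 1 else 0)).mono
    (mul_le_mul_of_nonneg_right (hB l) hr)
  simpa [mul_comm] using h

/-- Around every `𝔬`-point there is a chart that is invariant under a congruence subgroup, all of
whose elements are the time-one maps of analytic flows on the chart. -/
theorem exists_invariant_chart [LocallyCompactSpace K] [CharZero K]
    [Algebra.FiniteType (ValRing K) A] (hp : p.Prime) (hp1 : ‖(p : K)‖ < 1)
    (hV : AlgebraicGeometry.SmoothOfRelativeDimension m (AlgebraicGeometry.Spec.map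
      (CommRingCat.ofHom (algebraMap K (K ⊗[ValRing K] A)))))
    (x : Points (ValRing K) A) :
    ∃ (M : ℕ) (U : Set (Points (ValRing K) A)), x ∈ U ∧ IsClopen U ∧
      ∃ φ : (Fin m → ValRing K) ≃ U, IsAnalyticDiffeo φ ∧
        ∀ f ∈ congruenceSubgroup K A (‖(p : K)‖ ^ M) (by positivity),
          (∀ y ∈ U, f • y ∈ U) ∧
          ∃ Φ : ValRing K → U → U, IsAnalyticFlow (ValRing K).toSubring φ Φ ∧
            (∀ (n : ℤ) (y : U), (Φ (n : ValRing K) y).1 = (f ^ n) • y.1) ∧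
            ∀ Ψ : ValRing K → U → U, IsAnalyticFlow ⊤ φ Ψ →
              (∀ (n : ℤ) (y : U), (Ψ (n : ValRing K) y).1 = (f ^ n) • y.1) → Ψ = Φ := by
  have : ProperSpace K := ProperSpace.of_locallyCompactSpace K
  have hpK : (p : K) ≠ 0 := Nat.cast_ne_zero.mpr hp.ne_zero
  have hppos : 0 < ‖(p : K)‖ := norm_pos_iff.mpr hpK
  obtain ⟨N, a, e, b, ψ, hxa, hψ, hψa, hψb, hψu⟩ := exists_parametrization hp hp1 hV x
  obtain ⟨B, hB0, hB⟩ := exists_forall_norm_le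
    fun j (l : Fin N) => b j (fun i => if l = i then 1 else 0)
  obtain ⟨s, hs⟩ := exists_pow_mul_le hp1 B one_pos
  -- passing to the polydisk of radius `p ^ k` makes every `f` below congruent to the identity
  -- modulo `p ^ 2`: the exponent `2 * k` gained on differences exceeds by `2` the loss `e + k + s`
  -- in recovering the parameters
  obtain ⟨k, hk⟩ : ∃ k, k = e + s + 2 := ⟨_, rfl⟩
  have hBk : B * ‖(p : K)‖ ^ (2 * k) ≤ ‖(p : K)‖ ^ (e + k) * ‖(p : K)‖ ^ 2 := by
    have h1 : ‖(p : K)‖ ^ (2 * k) = ‖(p : K)‖ ^ s * (‖(p : K)‖ ^ (e + k) * ‖(p : K)‖ ^ 2) := by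
      rw [← pow_add, ← pow_add]; congr 1; omega
    rw [h1, ← mul_assoc]
    exact mul_le_of_le_one_left (by positivity) hs
  have hp2 : ‖(p : K)‖ ^ 2 ≤ 1 := pow_le_one₀ (norm_nonneg _) hp1.le
  have hBk' : B * ‖(p : K)‖ ^ (2 * k) ≤ ‖(p : K)‖ ^ (e + k) :=
    hBk.trans (mul_le_of_le_one_right (by positivity) hp2)
  have hMe : ‖(p : K)‖ ^ (2 * k) ≤ ‖(p : K)‖ ^ e :=
    pow_le_pow_of_le_one (norm_nonneg _) hp1.le (by omega)
  let co : Points (ValRing K) A → Fin N → K := fun y l => y.eval (a l)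
  have hco : Continuous co := continuous_pi fun l =>
    continuous_subtype_val.comp (Points.continuous_eval (a l))
  let U : Set (Points (ValRing K) A) :=
    {y | (∀ l, ‖co y l‖ ≤ ‖(p : K)‖ ^ e) ∧ ∀ j, ‖b j (co y)‖ ≤ ‖(p : K)‖ ^ (e + k)}
  have hUclopen : IsClopen U := by
    have hball : ∀ d : ℕ, IsClopen (Metric.closedBall (0 : K) (‖(p : K)‖ ^ d)) := fun d =>
      IsUltrametricDist.isClopen_closedBall 0 (pow_pos hppos d).ne'
    have hU : U = (⋂ l, (fun y => co y l) ⁻¹' Metric.closedBall (0 : K) (‖(p : K)‖ ^ e)) ∩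
        ⋂ j, (fun y => b j (co y)) ⁻¹' Metric.closedBall (0 : K) (‖(p : K)‖ ^ (e + k)) := by
      ext y
      simp [U]
    rw [hU]
    refine IsClopen.inter ?_ ?_
    · exact isClopen_iInter_of_finite fun l =>
        (hball e).preimage ((continuous_apply l).comp hco)
    · exact isClopen_iInter_of_finite fun j =>
        (hball (e + k)).preimage ((b j).continuous_of_finiteDimensional.comp hco)
  let π : ValRing K := (p : ValRing K) ^ k
  have hπ : (π : K) = (p : K) ^ k := by simp [π]
  have hπn : ‖(π : K)‖ ^ 2 = ‖(p : K)‖ ^ (2 * k) := by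
    rw [hπ, norm_pow, ← pow_mul, mul_comm]
  have hpek : (p : K) ^ (e + k) ≠ 0 := pow_ne_zero _ hpK
  have hb : ∀ (t : Fin m → ValRing K) j,
      b j (co (ψ fun i => π * t i)) = (p : K) ^ (e + k) * t j := fun t j => by
    rw [show b j (co (ψ fun i => π * t i)) = _ from hψb _ j, pow_add, ← hπ, mul_assoc]
    rfl
  have hmem : ∀ t : Fin m → ValRing K, (ψ fun i => π * t i) ∈ U := fun t => ⟨hψa _, fun j => by
    rw [hb, norm_mul, norm_pow]
    exact mul_le_of_le_one_right (by positivity) (norm_coe_le_one _)⟩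
  let φ : (Fin m → ValRing K) ≃ U :=
    { toFun := fun t => ⟨ψ fun i => π * t i, hmem t⟩
      invFun := fun y j => ⟨((p : K) ^ (e + k))⁻¹ * b j (co y.1), mem_valRing_iff.mpr (by
        rw [norm_mul, norm_inv, norm_pow, inv_mul_le_iff₀ (pow_pos hppos _), mul_one]
        exact y.2.2 j)⟩
      left_inv := fun t => by
        funext j
        refine Subtype.ext ?_
        change ((p : K) ^ (e + k))⁻¹ * b j (co (ψ fun i => π * t i)) = t j
        rw [hb, inv_mul_cancel_left₀ hpek]
      right_inv := fun y => by
        refine Subtype.ext (hψu y.1 y.2.1 _ fun j => ?_).symm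
        change b j (co y.1) = (p : K) ^ e * (π * (((p : K) ^ (e + k))⁻¹ * b j (co y.1)))
        rw [hπ, ← mul_assoc, ← pow_add, mul_inv_cancel_left₀ hpek] }
  have hφsymm : ∀ y j, (φ.symm y j : K) = ((p : K) ^ (e + k))⁻¹ * b j (co y.1) := fun _ _ => rfl
  refine ⟨2 * k, U, ?_, hUclopen, φ, ⟨fun c => ?_, fun i => ?_⟩, fun f hf => ?_⟩
  · have hx : co x = 0 := funext fun l => by simp [co, hxa]
    constructor
    · intro l
      rw [hx, Pi.zero_apply, norm_zero]
      positivity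
    · intro j
      rw [hx, map_zero, norm_zero]
      positivity
  · refine IsTateLE.isTate ((hψ c).comp (G := fun t i => π * t i) fun i => ?_)
    exact ((isTateLE_coord i).const_mul (π : K)).mono (by simpa using norm_coe_le_one π)
  · refine ⟨N, a, fun z => ((p : K) ^ (e + k))⁻¹ * b i fun l => (z l : K), ?_, fun y => hφsymm y i⟩
    exact ((IsTateLE.linearMap_comp (hB i) hB0 zero_le_one fun l => isTateLE_coord l).const_mul
      _).isTate_top
  · have hmove : ∀ (y : Points (ValRing K) A) l, ‖co (f • y) l - co y l‖ ≤ ‖(p : K)‖ ^ (2 * k) :=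
      fun y l => hf y (a l)
    have hfU : ∀ y ∈ U, f • y ∈ U := by
      intro y hy
      have h1 : co (f • y) = (co (f • y) - co y) + co y := (sub_add_cancel _ _).symm
      constructor
      · intro l
        rw [h1]
        exact (IsUltrametricDist.norm_add_le_max _ _).trans
          (max_le ((hmove y l).trans hMe) (hy.1 l))
      · intro j
        rw [h1, map_add]
        exact (IsUltrametricDist.norm_add_le_max _ _).trans (max_le
          ((norm_linearMap_le (hB j) hB0 (by positivity) (hmove y)).trans hBk') (hy.2 j))
    refine ⟨hfU, exists_unique_flow_on_chart hp hp1 φ f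
      (F := fun t => φ.symm ⟨f • (φ t).1, hfU _ (φ t).2⟩) (fun j => ?_) fun t => ?_⟩
    · have hdiff : ∀ l, IsTateLE (‖(p : K)‖ ^ (2 * k)) fun t =>
          co (f • (φ t).1) l - co (φ t).1 l := by
        intro l
        have h1 : IsTateLE 1 fun t => ((ψ t).eval (f.unop (a l)) - (ψ t).eval (a l) : K) :=
          (hψ _).sub (hψ _)
        have h2 := h1.comp_smul_of_norm_le π fun t => by
          rw [hπn]
          exact hf (ψ t) (a l)
        rw [hπn] at h2
        exact h2
      have h3 := (IsTateLE.linearMap_comp (b := b j)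
        (w := fun t => co (f • (φ t).1) - co (φ t).1) (hB j) hB0 (by positivity) hdiff).const_mul
          ((p : K) ^ (e + k))⁻¹
      have h4 : ‖((p : K) ^ (e + k))⁻¹‖ * (B * ‖(p : K)‖ ^ (2 * k)) ≤ ‖(p : K)‖ ^ 2 := by
        rw [norm_inv, norm_pow, inv_mul_le_iff₀ (pow_pos hppos _)]
        exact hBk
      convert! h3.mono h4 using 2 with t
      rw [hφsymm, map_sub, mul_sub, show b j (co (φ t).1) = _ from hb t j,
        inv_mul_cancel_left₀ hpek]
    · rw [Equiv.apply_symm_apply]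

end

end PadicFlow

open PadicFlow in
theorem mainTheorem7 {K : Type u} [NontriviallyNormedField K] [IsUltrametricDist K]
    [LocallyCompactSpace K] [CharZero K]
    {A : Type u} [CommRing A] [Algebra (PadicFlow.ValRing K) A]
    [Algebra.FiniteType (PadicFlow.ValRing K) A] (m : ℕ)
    (hV : AlgebraicGeometry.SmoothOfRelativeDimension m (AlgebraicGeometry.Spec.map
      (CommRingCat.ofHom (algebraMap K (K ⊗[PadicFlow.ValRing K] A)))))
    (Γ : Subgroup (PadicFlow.AutScheme (PadicFlow.ValRing K) A)) :
    ∃ Γ₀ : Subgroup Γ, Γ₀.FiniteIndex ∧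
      ∀ x : PadicFlow.Points (PadicFlow.ValRing K) A,
        ∃ U : Set (PadicFlow.Points (PadicFlow.ValRing K) A),
          x ∈ U ∧ IsCompact U ∧ IsOpen U ∧
          ∃ φ : (Fin m → PadicFlow.ValRing K) ≃ U,
            PadicFlow.IsAnalyticDiffeo φ ∧
            (∀ f ∈ Γ₀, (fun y => f • y) '' U = U) ∧
            ∀ f ∈ Γ₀, ∃ Φ : PadicFlow.ValRing K → U → U,
              PadicFlow.IsAnalyticFlow (PadicFlow.ValRing K).toSubring φ Φ ∧
              (∀ (n : ℤ) (y : U), (Φ (n : PadicFlow.ValRing K) y).1 = (f ^ n) • y.1) ∧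
              ∀ Ψ : PadicFlow.ValRing K → U → U,
                PadicFlow.IsAnalyticFlow ⊤ φ Ψ →
                (∀ (n : ℤ) (y : U), (Ψ (n : PadicFlow.ValRing K) y).1 = (f ^ n) • y.1) →
                Ψ = Φ := by
  obtain ⟨p, hp, hp1⟩ := exists_prime_norm_lt_one (K := K)
  have hppos : 0 < ‖(p : K)‖ := norm_pos_iff.mpr (Nat.cast_ne_zero.mpr hp.ne_zero)
  choose M U hxU hU φ hφ hΦ using exists_invariant_chart (A := A) hp hp1 hV
  obtain ⟨s, hs⟩ := isCompact_univ.elim_finite_subcover U (fun x => (hU x).isOpen)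
    fun x _ => Set.mem_iUnion.mpr ⟨x, hxU x⟩
  let M₀ := s.sup M
  let G := congruenceSubgroup K A (‖(p : K)‖ ^ M₀) (by positivity)
  have hG : G.FiniteIndex := finiteIndex_congruenceSubgroup (pow_pos hppos M₀)
  have hGM : ∀ x ∈ s, ∀ f ∈ G, f ∈ congruenceSubgroup K A (‖(p : K)‖ ^ M x) (by positivity) :=
    fun x hx f hf y a => (hf y a).trans
      (pow_le_pow_of_le_one (norm_nonneg _) hp1.le (Finset.le_sup hx))
  refine ⟨G.subgroupOf Γ, inferInstance, fun x => ?_⟩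
  obtain ⟨x₀, hx₀, hx⟩ : ∃ x₀ ∈ s, x ∈ U x₀ := by simpa using hs (Set.mem_univ x)
  refine ⟨U x₀, hx, (hU x₀).isClosed.isCompact, (hU x₀).isOpen, φ x₀, hφ x₀, fun f hf => ?_,
    fun f hf => ?_⟩
  · have h1 := (hΦ x₀ f (hGM x₀ hx₀ f hf)).1
    have h2 := (hΦ x₀ (f : AutScheme (ValRing K) A)⁻¹ (hGM x₀ hx₀ _ (G.inv_mem hf))).1
    refine Set.Subset.antisymm ?_ fun y hy => ⟨f⁻¹ • y, h2 y hy, smul_inv_smul f y⟩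
    rintro _ ⟨y, hy, rfl⟩
    exact h1 y hy
  · exact (hΦ x₀ f (hGM x₀ hx₀ f hf)).2
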